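/- Let $\mathbb D$ be the open unit disk in $\mathbb R^2\cong\mathbb C$, let $L^\infty_+(\mathbb D)$ be the set of real-valued $\gamma\in L^\infty(\mathbb D)$ with $\operatorname{ess\,inf}\gamma>0$, and let $L^2_\diamond(\partial\mathbb D)$ be the space of complex-valued $w\in L^2(\partial\mathbb D)$ with $\int_{\partial\mathbb D}w\,ds=0$, with inner product $\langle f,g\rangle=\int_{\partial\mathbb D}f\overline g\,ds$. For $\gamma\in L^\infty_+(\mathbb D)$ and $g\in L^2_\diamond(\partial\mathbb D)$ let $u\in H^1(\mathbb D)$ be the weak solution of $$\nabla\cdot(\gamma\nabla u)=0\ \text{in }\mathbb D,\qquad \nu\cdot\gamma\nabla u=g\ \text{on }\partial\mathbb D,\qquad \int_{\partial\mathbb D}u\,ds=0,$$ and let $\mathcal R(\gamma)$ be the bounded linear operator $g\mapsto u|_{\partial\mathbb D}$ on $L^2_\diamond(\partial\mathbb D)$ (the Neumann-to-Dirichlet map). Then $\mathcal R$ is well defined on $L^\infty_+(\mathbb D)$ and, as a map from $L^\infty_+(\mathbb D)\subset L^\infty(\mathbb D)$ to the bounded linear operators on $L^2_\diamond(\partial\mathbb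 D)$, it is Fréchet differentiable at $\gamma\equiv1$, with derivative $\mathcal R'(1)$. Let $f_n(\theta)=\frac1{\sqrt{2\pi}}e^{in\theta}$, $n\in\mathbb Z\setminus\{0\}$, let $C=ce^{i\zeta}$ with $0\le c<1$ and $\zeta\in\mathbb R$, let $0<R<1-c$, and let $\chi_{B_{C,R}}$ be the characteristic function of the open ball $B_{C,R}$ with centre $C$ and radius $R$. Then the matrix $$A'_{n,m}=\langle\mathcal R'(1)[\chi_{B_{C,R}}]f_m,f_n\rangle,\qquad n,m\in\mathbb Z\setminus\{0\},$$ has the following properties. (i) $A'$ is Hermitian: $A'=(A')^*$. (ii) $A'$ is centrohermitian: $A'_{n,m}=\overline{A'_{-n,-m}}$ for all $n,m$. (iii) $A'$ is block diagonal: $A'_{n,m}=0$ if $n<0<m$ or $m<0<n$. (iv) For $n>0$ and $m>0$ (with $0^0=1$), $$A'_{n,m}=-e^{i(m-n)\zeta}\sum_{k=0}^{\min\{n,m\}-1}\frac1{k+1}\binom{m-1}{k}\binom{n-1}{k}c^{m+n-2k-2}R^{2k+2}.$$ -/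

import Mathlib

open scoped ContDiff

noncomputable section

/-- Lebesgue measure on the open unit disk of the plane `ℂ = ℝ²`. -/
abbrev diskMeasure : MeasureTheory.Measure ℂ :=
  MeasureTheory.volume.restrict (Metric.ball (0 : ℂ) 1)

instance diskMeasure_finite : MeasureTheory.IsFiniteMeasure diskMeasure :=
  ⟨by
    rw [MeasureTheory.Measure.restrict_apply_univ]
    exact MeasureTheory.measure_ball_lt_top⟩

/-- Arc length measure on the unit circle, seen as a measure on the plane: the image of
`dθ` on an interval of length `2π` under `θ ↦ e^{iθ}`. -/
def circleMeasure : MeasureTheory.Measure ℂ :=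
  (MeasureTheory.volume.restrict (Set.Ioc (-Real.pi) Real.pi)).map
    (fun θ : ℝ => Complex.exp (θ * Complex.I))

theorem measurable_expI : Measurable (fun θ : ℝ => Complex.exp (θ * Complex.I)) := by
  fun_prop

instance circleMeasure_finite : MeasureTheory.IsFiniteMeasure circleMeasure := by
  unfold circleMeasure
  infer_instance

/-- The complex space `L²(𝔻)`. -/
abbrev L2Disk : Type := MeasureTheory.Lp ℂ 2 diskMeasure

/-- The real space `L^∞(𝔻)`. -/
abbrev LInfDisk : Type := MeasureTheory.Lp ℝ ⊤ diskMeasure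

/-- The complex space `L²(∂𝔻)`. -/
abbrev L2Circle : Type := MeasureTheory.Lp ℂ 2 circleMeasure

/-- The conductivities `L^∞_+(𝔻)`: bounded functions whose essential infimum is positive. -/
def LInfPos : Set LInfDisk :=
  {γ | ∃ ε : ℝ, 0 < ε ∧ ∀ᵐ z ∂diskMeasure, ε ≤ γ z}

theorem integrable_L2Circle (w : L2Circle) :
    MeasureTheory.Integrable (fun z => w z) circleMeasure :=
  (MeasureTheory.Lp.memLp w).integrable (by norm_num)

/-- The space `L²_⋄(∂𝔻)` of square integrable functions of mean zero on the unit circle. -/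
def L2CircleZero : Submodule ℂ L2Circle where
  carrier := {w | ∫ z, w z ∂circleMeasure = 0}
  add_mem' := by
    intro v w hv hw
    simp only [Set.mem_ofPred_eq] at hv hw ⊢
    rw [MeasureTheory.integral_congr_ae (MeasureTheory.Lp.coeFn_add v w)]
    simp only [Pi.add_apply]
    rw [MeasureTheory.integral_add (integrable_L2Circle v) (integrable_L2Circle w), hv, hw,
      add_zero]
  zero_mem' := by
    simp only [Set.mem_ofPred_eq]
    rw [MeasureTheory.integral_congr_ae (MeasureTheory.Lp.coeFn_zero ℂ 2 circleMeasure)]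
    simp
  smul_mem' := by
    intro a w hw
    simp only [Set.mem_ofPred_eq] at hw ⊢
    rw [MeasureTheory.integral_congr_ae (MeasureTheory.Lp.coeFn_smul a w)]
    simp only [Pi.smul_apply]
    rw [MeasureTheory.integral_smul, hw, smul_zero]

/-- The two coordinate directions of the plane. -/
def coordDir : Fin 2 → ℂ := ![1, Complex.I]

/-- The Sobolev space `H¹(𝔻)`: a square integrable function together with its
(unique) weak gradient, which is square integrable as well. -/
structure H1Disk where
  /-- the function -/
  toL2 : L2Disk
  /-- its weak partial derivatives -/
  grad : Fin 2 → L2Disk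
  weak : ∀ φ : ℂ → ℂ, ContDiff ℝ ∞ φ → HasCompactSupport φ →
    tsupport φ ⊆ Metric.ball (0 : ℂ) 1 → ∀ j : Fin 2,
      ∫ z, toL2 z * fderiv ℝ φ z (coordDir j) ∂diskMeasure
        = - ∫ z, grad j z * φ z ∂diskMeasure

/-- `h` is the boundary trace of `u ∈ H¹(𝔻)`: there are functions, smooth up to the boundary,
which converge to `u` in `H¹(𝔻)` and whose restrictions to the circle converge to `h` in
`L²(∂𝔻)`. Every `u` has exactly one trace. -/
def HasTrace (u : H1Disk) (h : L2Circle) : Prop :=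
  ∃ φ : ℕ → ℂ → ℂ, (∀ k, ContDiff ℝ ∞ (φ k)) ∧
    Filter.Tendsto
      (fun k => MeasureTheory.eLpNorm (fun z => φ k z - u.toL2 z) 2 diskMeasure)
      Filter.atTop (nhds 0) ∧
    (∀ j : Fin 2, Filter.Tendsto
      (fun k => MeasureTheory.eLpNorm
        (fun z => fderiv ℝ (φ k) z (coordDir j) - u.grad j z) 2 diskMeasure)
      Filter.atTop (nhds 0)) ∧
    Filter.Tendsto
      (fun k => MeasureTheory.eLpNorm (fun z => φ k z - h z) 2 circleMeasure)
      Filter.atTop (nhds 0)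

/-- `u ∈ H¹(𝔻)` with mean-zero boundary trace `h` is the weak solution of
`∇ · (γ ∇ u) = 0` in `𝔻`, `ν · γ ∇ u = g` on `∂𝔻`, that is,
`∫_𝔻 γ ∇u · conj ∇v dx = ∫_∂𝔻 g conj v ds` for all `v ∈ H¹(𝔻)`. -/
def IsWeakSolution (γ : LInfDisk) (g : L2CircleZero) (u : H1Disk) (h : L2CircleZero) : Prop :=
  HasTrace u h ∧
    ∀ (v : H1Disk) (k : L2Circle), HasTrace v k →
      ∫ z, (γ z : ℂ) * ∑ j : Fin 2, u.grad j z * starRingEnd ℂ (v.grad j z) ∂diskMeasure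
        = ∫ z, (g : L2Circle) z * starRingEnd ℂ (k z) ∂circleMeasure

open Classical in
/-- The Neumann-to-Dirichlet map `γ ↦ R(γ)`: for `γ ∈ L^∞_+(𝔻)`, `R(γ)` is the bounded operator
on `L²_⋄(∂𝔻)` that sends a Neumann datum `g` to the trace of the weak solution. Outside the open
set `L^∞_+(𝔻)` the value is irrelevant and set to zero. -/
def ndMap (γ : LInfDisk) : L2CircleZero →L[ℂ] L2CircleZero :=
  if h : γ ∈ LInfPos ∧ ∃ T : L2CircleZero →L[ℂ] L2CircleZero,
      ∀ g : L2CircleZero, ∃ u : H1Disk, IsWeakSolution γ g u (T g) then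
    h.2.choose
  else 0

/-- The constant conductivity `1`. -/
def unitConductivity : LInfDisk := MeasureTheory.Lp.const ⊤ diskMeasure (1 : ℝ)

/-- The characteristic function, in `L^∞(𝔻)`, of the open ball with centre `C` and radius `R`. -/
def ballIndicator (C : ℂ) (R : ℝ) : LInfDisk :=
  MeasureTheory.indicatorConstLp ⊤ (measurableSet_ball : MeasurableSet (Metric.ball C R))
    (MeasureTheory.measure_ne_top diskMeasure (Metric.ball C R)) (1 : ℝ)

theorem integral_circleMeasure_zpow (n : ℤ) (hn : n ≠ 0) :
    ∫ z : ℂ, z ^ n ∂circleMeasure = 0 := by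
  unfold circleMeasure
  rw [MeasureTheory.integral_map measurable_expI.aemeasurable
    (by fun_prop : Measurable fun z : ℂ => z ^ n).aestronglyMeasurable]
  rw [← intervalIntegral.integral_of_le (by linarith [Real.pi_pos])]
  have h1 : ∀ θ : ℝ, Complex.exp (θ * Complex.I) ^ n
      = Complex.exp ((n * Complex.I) * θ) := by
    intro θ
    rw [← Complex.exp_int_mul]
    ring_nf
  simp only [h1]
  have h2 : (n : ℂ) * Complex.I ≠ 0 :=
    mul_ne_zero (by exact_mod_cast hn) Complex.I_ne_zero
  rw [integral_exp_mul_complex h2]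
  have h3 : Complex.exp ((n : ℂ) * Complex.I * (Real.pi : ℝ))
      = Complex.exp ((n : ℂ) * Complex.I * ((-Real.pi : ℝ) : ℂ)) := by
    rw [Complex.exp_eq_exp_iff_exists_int]
    exact ⟨n, by push_cast; ring⟩
  rw [h3, sub_self, zero_div]

theorem ae_norm_eq_one_circleMeasure : ∀ᵐ z ∂circleMeasure, ‖z‖ = 1 := by
  unfold circleMeasure
  rw [MeasureTheory.ae_map_iff measurable_expI.aemeasurable
    (measurableSet_eq_fun measurable_norm measurable_const)]
  exact Filter.Eventually.of_forall fun θ => Complex.norm_exp_ofReal_mul_I θ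

theorem memLp_fourier (n : ℤ) :
    MeasureTheory.MemLp (fun z : ℂ => (1 / Real.sqrt (2 * Real.pi) : ℂ) * z ^ n) 2
      circleMeasure := by
  refine MeasureTheory.MemLp.of_bound (C := ‖(1 / Real.sqrt (2 * Real.pi) : ℂ)‖)
    (by fun_prop : Measurable fun z : ℂ =>
      (1 / Real.sqrt (2 * Real.pi) : ℂ) * z ^ n).aestronglyMeasurable ?_
  filter_upwards [ae_norm_eq_one_circleMeasure] with z hz
  rw [norm_mul, norm_zpow, hz, one_zpow, mul_one]

/-- The Fourier basis `f_n(θ) = e^{inθ} / √(2π)`, `n ∈ ℤ \ {0}`, of `L²_⋄(∂𝔻)`; on the circle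
`z = e^{iθ}` it reads `z ^ n / √(2π)`. -/
def trigBasis (n : {n : ℤ // n ≠ 0}) : L2CircleZero :=
  ⟨(memLp_fourier n.1).toLp _, by
    change ∫ z, ((memLp_fourier n.1).toLp _ : L2Circle) z ∂circleMeasure = 0
    rw [MeasureTheory.integral_congr_ae (memLp_fourier n.1).coeFn_toLp,
      MeasureTheory.integral_const_mul, integral_circleMeasure_zpow n.1 n.2, mul_zero]⟩

/-- The matrix of `R'(1)[η]` in the Fourier basis, `A'_{n,m} = ⟨R'(1)[η] f_m, f_n⟩`, where
`R'(1)` is the Fréchet derivative of the Neumann-to-Dirichlet map at the conductivity `1` and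
`⟨f, g⟩ = ∫ f conj g ds` (the inner product of Mathlib is linear in its second argument). -/
def ndDerivMatrix (η : LInfDisk) : Matrix {n : ℤ // n ≠ 0} {n : ℤ // n ≠ 0} ℂ :=
  fun n m => inner ℂ (trigBasis n) (fderiv ℝ ndMap unitConductivity η (trigBasis m))

end

open MeasureTheory

noncomputable section

/-! The weak problem is transferred to a Hilbert space of gradients. By the Poincaré inequality an
`H¹` function with mean-zero trace is controlled by its gradient, so these gradients form a closed
subspace `gradients` of `L²(𝔻)²`, and the trace becomes a bounded operator `T = gradTrace` from it
to `L²_⋄(∂𝔻)`. Let `B(γ) = conductivityOp γ` represent the form `∫ γ ∇u · conj ∇v`. The weak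
equation reads `B(γ) x = T* g`, where `B` is bounded and real-linear in `γ`, `B(1) = 1`, and `B(γ)`
is invertible by coercivity for `γ ∈ L^∞_+`. Hence `R(γ) = T B(γ)⁻¹ T*` (`isWeakSolution_iff`,
`ndMap_eq_ndOp`). Since `L^∞_+` is a neighbourhood of `1`, differentiating the inverse at the
identity gives `R'(1)η = -T B(η) T*` (`hasFDerivAt_ndMap`).

Thus `A'_{n,m} = -∫ η ∇u_m · conj ∇u_n`, where `∇u_n = T* f_n`. Here `u_n` is harmonic: `z^n / (n
√(2π))` for `n > 0`, and the conjugate of `u_{-n}` for `n < 0`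
(`exists_adjoint_gradTrace_trigBasis`). Properties (i)-(iii) already hold for the integrand
`trigPairing`: it is conjugate symmetric, it is conjugated when both indices change sign, and for
opposite signs it vanishes because `(1, i) · (1, i) = 0`. For positive indices it is `z^(m-1)
conj(z)^(n-1) / π`. Over the ball, the substitution `z = C + R w`, binomial expansion and
orthogonality of the monomials on the disk give (iv) (`integral_ball_pow_mul_conj_pow`).

The analytic input is the complex Green formula `integral_disk_dbar`, which yields the trace
inequality, the Neumann problem for `u_n` and the disk moments. -/

/-! ### Polar coordinates and Green's formula. -/

/-- The closed rectangle suits the divergence theorem; it differs from the open polar domain by a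
null set. -/
theorem integral_diskMeasure_polar {E : Type*} [NormedAddCommGroup E] [NormedSpace ℝ E]
    (f : ℂ → E) :
    ∫ z, f z ∂diskMeasure
      = ∫ p in Set.Icc ((0 : ℝ), -Real.pi) ((1 : ℝ), Real.pi),
          p.1 • f (p.1 * Complex.exp (p.2 * Complex.I)) := by
  have hset : (Set.Icc ((0 : ℝ), -Real.pi) ((1 : ℝ), Real.pi) : Set (ℝ × ℝ))
      =ᵐ[volume] (Set.Ioo (0 : ℝ) 1 ×ˢ Set.Ioo (-Real.pi) Real.pi : Set (ℝ × ℝ)) := by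
    rw [Set.Icc_prod_eq, Measure.volume_eq_prod]
    exact Measure.set_prod_ae_eq Ioo_ae_eq_Icc.symm Ioo_ae_eq_Icc.symm
  rw [setIntegral_congr_set hset, ← integral_indicator measurableSet_ball,
    ← Complex.integral_comp_polarCoord_symm]
  have hsub : (Set.Ioo (0 : ℝ) 1 ×ˢ Set.Ioo (-Real.pi) Real.pi : Set (ℝ × ℝ))
      ⊆ polarCoord.target := by
    rintro ⟨r, θ⟩ ⟨hr, hθ⟩
    exact ⟨hr.1, hθ⟩
  have hpol : ∀ p : ℝ × ℝ, Complex.polarCoord.symm p = p.1 * Complex.exp (p.2 * Complex.I) := by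
    intro p
    rw [Complex.polarCoord_symm_apply, Complex.exp_mul_I, Complex.ofReal_cos, Complex.ofReal_sin]
  rw [setIntegral_eq_of_subset_of_forall_sdiff_eq_zero
    polarCoord.open_target.measurableSet hsub]
  · symm
    refine setIntegral_congr_fun (measurableSet_Ioo.prod measurableSet_Ioo) ?_
    rintro ⟨r, θ⟩ ⟨hr, hθ⟩
    simp only
    rw [Set.indicator_of_mem, hpol]
    rw [hpol, mem_ball_zero_iff, norm_mul, Complex.norm_exp_ofReal_mul_I, mul_one,
      Complex.norm_real, Real.norm_eq_abs, abs_of_pos hr.1]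
    exact hr.2
  · rintro ⟨r, θ⟩ ⟨⟨hr, hθ⟩, hn⟩
    rw [Set.indicator_of_notMem, smul_zero]
    rw [hpol, mem_ball_zero_iff, norm_mul, Complex.norm_exp_ofReal_mul_I, mul_one,
      Complex.norm_real, Real.norm_eq_abs, abs_of_pos hr]
    intro h
    exact hn ⟨⟨hr, h⟩, hθ⟩

theorem integral_circleMeasure {E : Type*} [NormedAddCommGroup E] [NormedSpace ℝ E]
    [SecondCountableTopologyEither ℂ E]
    (f : ℂ → E) (hf : Continuous f) :
    ∫ z, f z ∂circleMeasure
      = ∫ θ in -Real.pi..Real.pi, f (Complex.exp (θ * Complex.I)) := by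
  unfold circleMeasure
  rw [intervalIntegral.integral_of_le (by linarith [Real.pi_pos]),
    integral_map measurable_expI.aemeasurable hf.aestronglyMeasurable]

/-- Green's formula on the disk, in complex form. -/
theorem integral_disk_dbar (G : ℂ → ℂ) (hG : ContDiff ℝ 1 G) :
    ∫ z, (fderiv ℝ G z 1 + Complex.I * fderiv ℝ G z Complex.I) ∂diskMeasure
      = ∫ z, z * G z ∂circleMeasure := by
  set e : ℝ × ℝ → ℂ := fun p => p.1 * Complex.exp (p.2 * Complex.I) with he
  have hcont : Continuous fun z => fderiv ℝ G z := hG.continuous_fderiv (by norm_num)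
  have h1 : ∀ p : ℝ × ℝ, HasFDerivAt (fun p : ℝ × ℝ => (p.1 : ℂ))
      (Complex.ofRealCLM.comp (ContinuousLinearMap.fst ℝ ℝ ℝ)) p := fun p =>
    (Complex.ofRealCLM.comp (ContinuousLinearMap.fst ℝ ℝ ℝ)).hasFDerivAt
  have h2 : ∀ p : ℝ × ℝ, HasFDerivAt (fun p : ℝ × ℝ => Complex.exp ((p.2 : ℂ) * Complex.I))
      (Complex.exp ((p.2 : ℂ) * Complex.I) •
        ((Complex.ofRealCLM.comp (ContinuousLinearMap.snd ℝ ℝ ℝ)).smulRight Complex.I)) p := by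
    intro p
    exact (((Complex.ofRealCLM.comp (ContinuousLinearMap.snd ℝ ℝ ℝ)).smulRight
      Complex.I).hasFDerivAt).cexp
  have h3 : ∀ p, HasFDerivAt e _ p := fun p => (h1 p).mul (h2 p)
  have h4 : ∀ p, HasFDerivAt (fun p => G (e p)) _ p := fun p =>
    ((hG.differentiable (by norm_num) (e p)).hasFDerivAt).comp p (h3 p)
  have hP : ∀ p, HasFDerivAt (fun p => e p * G (e p)) _ p := fun p => (h3 p).mul (h4 p)
  have hQ : ∀ p : ℝ × ℝ, HasFDerivAt
      (fun p : ℝ × ℝ => (Complex.I * Complex.exp ((p.2 : ℂ) * Complex.I)) * G (e p)) _ p :=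
    fun p => ((h2 p).const_mul Complex.I).mul (h4 p)
  -- With `E = e^{iθ}`, `∂_x + i ∂_y = E (∂_r + (i/r) ∂_θ)`. The field `(r E G, i E G)` therefore
  -- has divergence `r (∂_x G + i ∂_y G)`: the two terms in which `G` is not differentiated cancel.
  have hdiv := integral_divergence_prod_Icc_of_hasFDerivAt_of_le
    (fun p => e p * G (e p))
    (fun p : ℝ × ℝ => (Complex.I * Complex.exp ((p.2 : ℂ) * Complex.I)) * G (e p))
    _ _ ((0 : ℝ), -Real.pi) ((1 : ℝ), Real.pi)
    (by constructor <;> simp; linarith [Real.pi_pos])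
    (fun p _ => (hP p).continuousAt.continuousWithinAt)
    (fun p _ => (hQ p).continuousAt.continuousWithinAt) (fun p _ => hP p) (fun p _ => hQ p)
  have hlin : ∀ (L : ℂ →L[ℝ] ℂ) (w : ℂ), L w = w.re * L 1 + w.im * L Complex.I := by
    intro L w
    conv_lhs => rw [← Complex.re_add_im w]
    have h5 : ((w.re : ℂ) + w.im * Complex.I) = w.re • (1 : ℂ) + w.im • Complex.I := by simp
    rw [h5, map_add, map_smul, map_smul, Complex.real_smul, Complex.real_smul]
  have hcirc : ∀ θ : ℝ, starRingEnd ℂ (Complex.exp (θ * Complex.I)) * Complex.exp (θ * Complex.I)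
      = 1 := by
    intro θ
    rw [mul_comm, Complex.mul_conj, Complex.normSq_eq_norm_sq, Complex.norm_exp_ofReal_mul_I]
    norm_num
  have hint : ∀ p : ℝ × ℝ, ∀ E D₁ D₂ g : ℂ, starRingEnd ℂ E * E = 1 →
      (p.1 * E) * (E.re * D₁ + E.im * D₂) + g * E
        + ((Complex.I * E) * ((p.1 * (E * Complex.I)).re * D₁ + (p.1 * (E * Complex.I)).im * D₂)
          + g * (Complex.I * (E * Complex.I)))
        = p.1 • (D₁ + Complex.I * D₂) := by
    intro p E D₁ D₂ g hE
    have hE' : ((E.re : ℂ) - E.im * Complex.I) * E = 1 := by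
      rw [← hE]; congr 1
      apply Complex.ext <;> simp
    simp only [Complex.mul_re, Complex.mul_im, Complex.ofReal_re, Complex.ofReal_im, Complex.I_re,
      Complex.I_im, Complex.real_smul]
    push_cast
    linear_combination (p.1 : ℂ) * (D₁ + Complex.I * D₂) * hE' + (E * g +
      (p.1 : ℂ) * E * E.im * D₂)  * Complex.I_sq
  have hkey : ∀ p : ℝ × ℝ, (p.1 * Complex.exp (p.2 * Complex.I)) *
      (fderiv ℝ G (e p) (Complex.exp (p.2 * Complex.I))) + G (e p) * Complex.exp (p.2 * Complex.I)
      + ((Complex.I * Complex.exp (p.2 * Complex.I)) *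
        (fderiv ℝ G (e p) (p.1 * (Complex.exp (p.2 * Complex.I) * Complex.I)))
        + G (e p) * (Complex.I * (Complex.exp (p.2 * Complex.I) * Complex.I)))
      = p.1 • (fderiv ℝ G (e p) 1 + Complex.I * fderiv ℝ G (e p) Complex.I) := by
    intro p
    rw [hlin _ (Complex.exp (p.2 * Complex.I)),
      hlin _ (p.1 * (Complex.exp (p.2 * Complex.I) * Complex.I))]
    exact hint p (Complex.exp (p.2 * Complex.I)) _ _ (G (e p)) (hcirc p.2)
  simp only [add_apply, smul_apply, ContinuousLinearMap.comp_apply,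
    ContinuousLinearMap.smulRight_apply, ContinuousLinearMap.coe_fst',
    ContinuousLinearMap.coe_snd', Complex.ofRealCLM_apply, smul_eq_mul,
    Complex.ofReal_zero, Complex.ofReal_one, mul_zero, zero_mul, mul_one, one_mul, zero_add,
    add_zero] at hdiv
  have heq : ∀ p : ℝ × ℝ, e p = p.1 * Complex.exp (p.2 * Complex.I) := fun p => rfl
  simp only [← heq] at hkey
  simp only [hkey] at hdiv
  have hce : Continuous e := by rw [he]; fun_prop
  have hc1 : Continuous fun p : ℝ × ℝ =>
      p.1 • (fderiv ℝ G (e p) 1 + Complex.I * fderiv ℝ G (e p) Complex.I) := by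
    have := hcont.comp hce
    fun_prop
  have hfin := hdiv (hc1.continuousOn.integrableOn_compact isCompact_Icc)
  rw [integral_diskMeasure_polar, integral_circleMeasure (fun z => z * G z)
    (continuous_id.mul hG.continuous)]
  refine hfin.trans ?_
  -- The sides `θ = ±π` cancel by periodicity and the side `r = 0` vanishes with the factor `r`;
  -- only `r = 1` remains.
  have hper : ∀ x : ℝ, e (x, Real.pi) = e (x, -Real.pi) := by
    intro x
    simp only [he, Complex.ofReal_neg, neg_mul]
    rw [Complex.exp_neg, Complex.exp_pi_mul_I]
    norm_num
  simp only [hper, Complex.ofReal_neg, neg_mul, Complex.exp_neg, Complex.exp_pi_mul_I]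
  simp [he]

theorem Continuous.integrable_diskMeasure {E : Type*} [NormedAddCommGroup E]
    {f : ℂ → E} (hf : Continuous f) : Integrable f diskMeasure :=
  (hf.continuousOn.integrableOn_compact (isCompact_closedBall (0 : ℂ) 1)).mono_set
    Metric.ball_subset_closedBall

/-! ### Trace and Poincaré inequalities for smooth functions. -/

/-- The squared norm of the gradient of a function on the plane. -/
def gradSq (φ : ℂ → ℂ) (z : ℂ) : ℝ := ‖fderiv ℝ φ z 1‖ ^ 2 + ‖fderiv ℝ φ z Complex.I‖ ^ 2

theorem gradSq_nonneg (φ : ℂ → ℂ) (z : ℂ) : 0 ≤ gradSq φ z := by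
  unfold gradSq; positivity

theorem continuous_gradSq {φ : ℂ → ℂ} (hφ : ContDiff ℝ 1 φ) : Continuous (gradSq φ) := by
  have : Continuous fun z => fderiv ℝ φ z := hφ.continuous_fderiv (by norm_num)
  unfold gradSq
  fun_prop

/-- Green's formula is applied to `conj(z) |φ|²`, because `z conj(z) = 1` on the circle. The
derivative of `conj(z)` contributes `2|φ|²`, and the cross terms `2|∂_jφ||φ| ≤ |∂_jφ|² + |φ|²` raise
the constant to `4`. -/
theorem integral_circle_norm_sq_le {φ : ℂ → ℂ} (hφ : ContDiff ℝ 1 φ) :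
    ∫ z, ‖φ z‖ ^ 2 ∂circleMeasure
      ≤ 4 * ∫ z, ‖φ z‖ ^ 2 ∂diskMeasure + ∫ z, gradSq φ z ∂diskMeasure := by
  have hconj : ContDiff ℝ 1 (fun z : ℂ => starRingEnd ℂ z) := Complex.conjCLE.contDiff
  set G : ℂ → ℂ := fun z => starRingEnd ℂ z * (φ z * starRingEnd ℂ (φ z)) with hGdef
  have hG : ContDiff ℝ 1 G := hconj.mul (hφ.mul (hconj.comp hφ))
  have hder : ∀ z w : ℂ, fderiv ℝ G z w
      = starRingEnd ℂ w * (φ z * starRingEnd ℂ (φ z)) + starRingEnd ℂ z *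
        (fderiv ℝ φ z w * starRingEnd ℂ (φ z) + φ z * starRingEnd ℂ (fderiv ℝ φ z w)) := by
    intro z w
    have h1 : HasFDerivAt (fun z : ℂ => starRingEnd ℂ z) (Complex.conjCLE : ℂ →L[ℝ] ℂ) z :=
      Complex.conjCLE.hasFDerivAt
    have h2 : HasFDerivAt φ (fderiv ℝ φ z) z :=
      (hφ.differentiable (by norm_num) z).hasFDerivAt
    have h3 : HasFDerivAt (fun z : ℂ => starRingEnd ℂ (φ z))
        ((Complex.conjCLE : ℂ →L[ℝ] ℂ).comp (fderiv ℝ φ z)) z :=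
      (Complex.conjCLE.hasFDerivAt (x := φ z)).comp z h2
    have h4 : HasFDerivAt G _ z := h1.mul (h2.mul h3)
    rw [h4.fderiv]
    simp
    ring
  have hgreen := integral_disk_dbar G hG
  have hnsq : ∀ w : ℂ, w * starRingEnd ℂ w = ((‖w‖ ^ 2 : ℝ) : ℂ) := by
    intro w
    rw [Complex.mul_conj, Complex.normSq_eq_norm_sq]
  have hR : ∫ z, z * G z ∂circleMeasure = ((∫ z, ‖φ z‖ ^ 2 ∂circleMeasure : ℝ) : ℂ) := by
    rw [← integral_complex_ofReal]
    refine integral_congr_ae ?_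
    filter_upwards [ae_norm_eq_one_circleMeasure] with z hz
    rw [hGdef]
    simp only
    rw [← mul_assoc, hnsq, hnsq, hz]
    norm_num
  have hnn : 0 ≤ ∫ z, ‖φ z‖ ^ 2 ∂circleMeasure := integral_nonneg fun _ => by positivity
  have h4 : ∫ z, ‖φ z‖ ^ 2 ∂circleMeasure = ‖∫ z, z * G z ∂circleMeasure‖ := by
    rw [hR, Complex.norm_real, Real.norm_of_nonneg hnn]
  have hcφ : Continuous φ := hφ.continuous
  have hi1 : Integrable (fun z => ‖φ z‖ ^ 2) diskMeasure :=
    Continuous.integrable_diskMeasure (by fun_prop)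
  have hi2 := (continuous_gradSq hφ).integrable_diskMeasure
  rw [h4, ← hgreen, ← integral_const_mul, ← integral_add (hi1.const_mul 4) hi2]
  refine norm_integral_le_of_norm_le ((hi1.const_mul 4).add hi2) ?_
  filter_upwards [ae_restrict_mem measurableSet_ball] with z hz
  rw [mem_ball_zero_iff] at hz
  rw [hder, hder]
  set a := fderiv ℝ φ z 1
  set b := fderiv ℝ φ z Complex.I
  have e : starRingEnd ℂ 1 * (φ z * starRingEnd ℂ (φ z)) + starRingEnd ℂ z *
        (a * starRingEnd ℂ (φ z) + φ z * starRingEnd ℂ a) + Complex.I * (starRingEnd ℂ Complex.I *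
        (φ z * starRingEnd ℂ (φ z)) + starRingEnd ℂ z *
        (b * starRingEnd ℂ (φ z) + φ z * starRingEnd ℂ b))
      = 2 * (φ z * starRingEnd ℂ (φ z)) + starRingEnd ℂ z * ((a * starRingEnd ℂ (φ z)
        + φ z * starRingEnd ℂ a) + Complex.I * (b * starRingEnd ℂ (φ z) + φ z * starRingEnd ℂ b)) := by
    simp only [map_one, Complex.conj_I]
    linear_combination -(φ z * starRingEnd ℂ (φ z)) * Complex.I_sq
  rw [e]
  have n1 : ‖2 * (φ z * starRingEnd ℂ (φ z))‖ = 2 * ‖φ z‖ ^ 2 := by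
    rw [norm_mul, norm_mul, RCLike.norm_conj, Complex.norm_ofNat]; ring
  have n2 : ∀ a : ℂ, ‖a * starRingEnd ℂ (φ z) + φ z * starRingEnd ℂ a‖ ≤ 2 * ‖a‖ * ‖φ z‖ := by
    intro a
    refine (norm_add_le _ _).trans (le_of_eq ?_)
    rw [norm_mul, norm_mul, RCLike.norm_conj, RCLike.norm_conj]; ring
  have n3 : ‖(a * starRingEnd ℂ (φ z)
        + φ z * starRingEnd ℂ a) + Complex.I * (b * starRingEnd ℂ (φ z) + φ z * starRingEnd ℂ b)‖
      ≤ 2 * ‖a‖ * ‖φ z‖ + 2 * ‖b‖ * ‖φ z‖ := by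
    refine (norm_add_le _ _).trans (add_le_add (n2 a) ?_)
    rw [norm_mul, Complex.norm_I, one_mul]
    exact n2 b
  refine (norm_add_le _ _).trans ?_
  rw [n1, norm_mul, RCLike.norm_conj]
  have n4 := mul_le_mul hz.le n3 (norm_nonneg _) zero_le_one
  have n5 : gradSq φ z = ‖a‖ ^ 2 + ‖b‖ ^ 2 := rfl
  rw [n5]
  nlinarith [sq_nonneg (‖a‖ - ‖φ z‖), sq_nonneg (‖b‖ - ‖φ z‖)]

theorem norm_fderiv_apply_sq_le (φ : ℂ → ℂ) (z w : ℂ) :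
    ‖fderiv ℝ φ z w‖ ^ 2 ≤ ‖w‖ ^ 2 * gradSq φ z := by
  have h : fderiv ℝ φ z w = w.re • fderiv ℝ φ z 1 + w.im • fderiv ℝ φ z Complex.I := by
    rw [← map_smul, ← map_smul, ← map_add]
    congr 1
    simp
  have h2 : ‖fderiv ℝ φ z w‖ ≤ |w.re| * ‖fderiv ℝ φ z 1‖ + |w.im| * ‖fderiv ℝ φ z Complex.I‖ := by
    rw [h]
    refine (norm_add_le _ _).trans (le_of_eq ?_)
    rw [norm_smul, norm_smul, Real.norm_eq_abs, Real.norm_eq_abs]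
  have h3 : ‖w‖ ^ 2 = |w.re| ^ 2 + |w.im| ^ 2 := by
    rw [← Complex.normSq_eq_norm_sq, Complex.normSq_apply, sq_abs, sq_abs]; ring
  have h4 := pow_le_pow_left₀ (norm_nonneg _) h2 2
  refine h4.trans ?_
  rw [h3, gradSq]
  nlinarith [sq_nonneg (|w.re| * ‖fderiv ℝ φ z Complex.I‖ - |w.im| * ‖fderiv ℝ φ z 1‖)]

/-- The variance of `f` on the unit interval is nonnegative. -/
theorem sq_intervalIntegral_le {f : ℝ → ℝ} (hf : Continuous f) :
    (∫ t in (0 : ℝ)..1, f t) ^ 2 ≤ ∫ t in (0 : ℝ)..1, f t ^ 2 := by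
  set m := ∫ t in (0 : ℝ)..1, f t with hm
  have h : 0 ≤ ∫ t in (0 : ℝ)..1, (f t - m) ^ 2 :=
    intervalIntegral.integral_nonneg zero_le_one fun _ _ => by positivity
  have h2 : ∫ t in (0 : ℝ)..1, (f t - m) ^ 2
      = (∫ t in (0 : ℝ)..1, f t ^ 2) - 2 * m * m + m ^ 2 := by
    have e : ∀ t, (f t - m) ^ 2 = (f t ^ 2 - (2 * m) * f t) + m ^ 2 := fun t => by ring
    simp only [e]
    rw [intervalIntegral.integral_add, intervalIntegral.integral_sub,
      intervalIntegral.integral_const_mul, intervalIntegral.integral_const, ← hm]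
    · simp
    all_goals exact Continuous.intervalIntegrable (by fun_prop) _ _
  nlinarith

theorem norm_sub_sq_le_integral_gradSq {φ : ℂ → ℂ} (hφ : ContDiff ℝ 1 φ) (x y : ℂ) :
    ‖φ x - φ y‖ ^ 2 ≤ ‖x - y‖ ^ 2 * ∫ t in (0 : ℝ)..1, gradSq φ (y + t • (x - y)) := by
  have hc : Continuous fun z => fderiv ℝ φ z := hφ.continuous_fderiv (by norm_num)
  have hcp : Continuous fun t : ℝ => y + t • (x - y) := by fun_prop
  have hcf : Continuous fun t : ℝ => fderiv ℝ φ (y + t • (x - y)) := hc.comp hcp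
  have hd : ∀ t : ℝ, HasDerivAt (fun t : ℝ => φ (y + t • (x - y)))
      (fderiv ℝ φ (y + t • (x - y)) (x - y)) t := by
    intro t
    have h1 : HasDerivAt (fun t : ℝ => y + t • (x - y)) (x - y) t := by
      simpa using ((hasDerivAt_id t).smul_const (x - y)).const_add y
    exact (hφ.differentiable (by norm_num) _).hasFDerivAt.comp_hasDerivAt t h1
  have hftc := intervalIntegral.integral_eq_sub_of_hasDerivAt (a := 0) (b := 1)
    (fun t _ => hd t) (Continuous.intervalIntegrable (by fun_prop) _ _)
  have hxy : φ x - φ y = ∫ t in (0 : ℝ)..1, fderiv ℝ φ (y + t • (x - y)) (x - y) := by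
    rw [hftc]; simp
  have hn : ‖φ x - φ y‖ ≤ ∫ t in (0 : ℝ)..1, ‖fderiv ℝ φ (y + t • (x - y)) (x - y)‖ := by
    rw [hxy]; exact intervalIntegral.norm_integral_le_integral_norm zero_le_one
  refine (pow_le_pow_left₀ (norm_nonneg _) hn 2).trans ?_
  refine (sq_intervalIntegral_le (by fun_prop)).trans ?_
  rw [← intervalIntegral.integral_const_mul]
  have hcg := (continuous_gradSq hφ).comp hcp
  refine intervalIntegral.integral_mono_on zero_le_one
    (Continuous.intervalIntegrable (by fun_prop) _ _)
    (Continuous.intervalIntegrable (continuous_const.mul hcg) _ _) ?_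
  intro t _
  exact norm_fderiv_apply_sq_le φ _ _

/-- The Jacobian factor is `s⁻²`, at most `4` once `s ≥ 1/2`. -/
theorem lintegral_comp_add_smul_le {F : ℂ → ENNReal} (hF : Measurable F) {s : ℝ} (hs : 1 / 2 ≤ s)
    (a : ℂ) : ∫⁻ x, F (a + s • x) ≤ 4 * ∫⁻ x, F x := by
  have hs0 : s ≠ 0 := by linarith
  have h1 : ∫⁻ x, F (a + s • x) = ∫⁻ x, F (a + x) ∂(Measure.map (fun x : ℂ => s • x) volume) := by
    rw [lintegral_map (f := fun x => F (a + x)) (hF.comp (measurable_const_add a)) (measurable_const_smul s)]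
  have h2 : Measure.map (fun x : ℂ => s • x) volume
      = ENNReal.ofReal |(s ^ Module.finrank ℝ ℂ)⁻¹| • (volume : Measure ℂ) :=
    Measure.map_addHaar_smul volume hs0
  rw [h1, h2, lintegral_smul_measure, lintegral_add_left_eq_self, smul_eq_mul]
  gcongr
  rw [Complex.finrank_real_complex, abs_of_nonneg (by positivity)]
  calc ENNReal.ofReal (s ^ 2)⁻¹ ≤ ENNReal.ofReal 4 := by
        apply ENNReal.ofReal_le_ofReal
        rw [inv_le_comm₀ (by positivity) (by norm_num)]
        nlinarith
    _ = 4 := by norm_num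

/-- The Poincaré inequality on the disk. -/
theorem exists_integral_norm_sub_sq_le {φ : ℂ → ℂ} (hφ : ContDiff ℝ 1 φ) :
    ∃ a : ℂ, ∫ z, ‖φ z - a‖ ^ 2 ∂diskMeasure ≤ 16 * ∫ z, gradSq φ z ∂diskMeasure := by
  set D : Set ℂ := Metric.ball 0 1 with hD
  have hDm : MeasurableSet D := measurableSet_ball
  have hcg := continuous_gradSq hφ
  set F : ℂ → ENNReal := D.indicator fun z => ENNReal.ofReal (gradSq φ z) with hFdef
  have hF : Measurable F := (hcg.measurable.ennreal_ofReal).indicator hDm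
  have hcφ : Continuous φ := hφ.continuous
  -- The factor `4` is the square of the diameter; by convexity the segment stays in the disk.
  have hpt : ∀ x ∈ D, ∀ y ∈ D, ENNReal.ofReal (‖φ x - φ y‖ ^ 2)
      ≤ 4 * ∫⁻ t in Set.Icc (0 : ℝ) 1, F (y + t • (x - y)) := by
    intro x hx y hy
    have hcp : Continuous fun t : ℝ => gradSq φ (y + t • (x - y)) :=
      hcg.comp (by fun_prop)
    have h1 : ‖x - y‖ ^ 2 ≤ 4 := by
      have : ‖x - y‖ ≤ 2 := by
        rw [hD, mem_ball_zero_iff] at hx hy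
        linarith [norm_sub_le x y]
      nlinarith [norm_nonneg (x - y)]
    have hnn : 0 ≤ ∫ t in (0 : ℝ)..1, gradSq φ (y + t • (x - y)) :=
      intervalIntegral.integral_nonneg zero_le_one fun _ _ => gradSq_nonneg _ _
    have h2 : ‖φ x - φ y‖ ^ 2 ≤ 4 * ∫ t in Set.Icc (0 : ℝ) 1, gradSq φ (y + t • (x - y)) := by
      rw [integral_Icc_eq_integral_Ioc, ← intervalIntegral.integral_of_le zero_le_one]
      exact (norm_sub_sq_le_integral_gradSq hφ x y).trans (mul_le_mul_of_nonneg_right h1 hnn)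
    refine (ENNReal.ofReal_le_ofReal h2).trans ?_
    rw [ENNReal.ofReal_mul (by norm_num), ofReal_integral_eq_lintegral_ofReal
      (hcp.continuousOn.integrableOn_compact isCompact_Icc)
      (Filter.Eventually.of_forall fun _ => gradSq_nonneg _ _)]
    refine mul_le_mul' (by norm_num) (le_of_eq ?_)
    refine setLIntegral_congr_fun measurableSet_Icc ?_
    intro t ht
    have hmem : y + t • (x - y) ∈ D :=
      (convex_ball (0 : ℂ) 1).add_smul_sub_mem hy hx ht
    simp only [hFdef, Set.indicator_of_mem hmem]
  have hvol : volume D ≠ 0 := (Metric.measure_ball_pos volume (0 : ℂ) one_pos).ne'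
  have hvol' : volume D ≠ ⊤ := measure_ball_lt_top.ne
  have ht : ∀ t : ℝ, ∫⁻ y in D, ∫⁻ x in D, F (y + t • (x - y)) ≤ 4 * volume D * ∫⁻ z, F z := by
    intro t
    have hm2 : Measurable fun p : ℂ × ℂ => F (p.1 + t • (p.2 - p.1)) := hF.comp (by fun_prop)
    have hconst : ∫⁻ _ in D, 4 * ∫⁻ z, F z = 4 * volume D * ∫⁻ z, F z := by
      rw [lintegral_const, Measure.restrict_apply_univ]; ring
    -- In `(1 - t) y + t x` one of the coefficients is at least `1/2`; the inner integration is
    -- taken over the corresponding variable, so the Jacobian stays bounded.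
    rcases le_total (1 / 2) t with h | h
    · rw [← hconst]
      refine lintegral_mono fun y => ?_
      refine (setLIntegral_le_lintegral _ _).trans ?_
      have e : ∀ x, y + t • (x - y) = (y - t • y) + t • x := fun x => by rw [smul_sub]; ring
      simp only [e]
      exact lintegral_comp_add_smul_le hF h _
    · rw [lintegral_lintegral_swap hm2.aemeasurable, ← hconst]
      refine lintegral_mono fun x => ?_
      refine (setLIntegral_le_lintegral _ _).trans ?_
      have e : ∀ y, y + t • (x - y) = t • x + (1 - t) • y := fun y => by
        rw [smul_sub, sub_smul, one_smul]; ring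
      simp only [e]
      exact lintegral_comp_add_smul_le hF (by linarith) _
  have hmN : Measurable fun p : ℂ × ℂ => ENNReal.ofReal (‖φ p.2 - φ p.1‖ ^ 2) := by
    have : Continuous fun p : ℂ × ℂ => ‖φ p.2 - φ p.1‖ ^ 2 := by fun_prop
    exact this.measurable.ennreal_ofReal
  have hdouble : ∫⁻ y in D, ∫⁻ x in D, ENNReal.ofReal (‖φ x - φ y‖ ^ 2)
      ≤ volume D * (16 * ∫⁻ z, F z) := by
    calc ∫⁻ y in D, ∫⁻ x in D, ENNReal.ofReal (‖φ x - φ y‖ ^ 2)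
        ≤ ∫⁻ y in D, ∫⁻ x in D, 4 * ∫⁻ t in Set.Icc (0 : ℝ) 1, F (y + t • (x - y)) := by
          refine setLIntegral_mono' hDm fun y hy => setLIntegral_mono' hDm fun x hx => ?_
          exact hpt x hx y hy
      _ = 4 * ∫⁻ t in Set.Icc (0 : ℝ) 1, ∫⁻ y in D, ∫⁻ x in D, F (y + t • (x - y)) := by
          have hm3 : ∀ y : ℂ, Measurable fun p : ℂ × ℝ => F (y + p.2 • (p.1 - y)) := fun y =>
            hF.comp (by fun_prop)
          have hm4 : Measurable fun p : (ℂ × ℝ) × ℂ => F (p.1.1 + p.1.2 • (p.2 - p.1.1)) :=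
            hF.comp (by fun_prop)
          have e : ∀ y : ℂ, ∫⁻ x in D, 4 * ∫⁻ t in Set.Icc (0 : ℝ) 1, F (y + t • (x - y))
              = 4 * ∫⁻ t in Set.Icc (0 : ℝ) 1, ∫⁻ x in D, F (y + t • (x - y)) := by
            intro y
            rw [lintegral_const_mul _ (hm3 y).lintegral_prod_right',
              lintegral_lintegral_swap (hm3 y).aemeasurable]
          simp only [e]
          have hm5 : Measurable fun p : ℂ × ℝ => ∫⁻ x in D, F (p.1 + p.2 • (x - p.1)) :=
            hm4.lintegral_prod_right'
          rw [lintegral_const_mul _ hm5.lintegral_prod_right',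
            lintegral_lintegral_swap hm5.aemeasurable]
      _ ≤ 4 * ∫⁻ _ in Set.Icc (0 : ℝ) 1, 4 * volume D * ∫⁻ z, F z := by
          gcongr with t
          exact ht t
      _ = volume D * (16 * ∫⁻ z, F z) := by
          rw [lintegral_const, Measure.restrict_apply_univ, Real.volume_Icc]
          norm_num
          ring
  -- Some `y` does no worse than the average of the double integral, so the value `φ y` can serve as
  -- the constant `a`.
  obtain ⟨y, hy, hle⟩ := exists_le_setLAverage hvol hvol'
    (hmN.lintegral_prod_right' (ν := volume.restrict D)).aemeasurable
  refine ⟨φ y, ?_⟩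
  have hle2 : ∫⁻ x in D, ENNReal.ofReal (‖φ x - φ y‖ ^ 2) ≤ 16 * ∫⁻ z, F z := by
    refine hle.trans ?_
    rw [setLAverage_eq]
    exact ENNReal.div_le_of_le_mul' hdouble
  have hi1 : Integrable (fun z => ‖φ z - φ y‖ ^ 2) diskMeasure :=
    Continuous.integrable_diskMeasure (by fun_prop)
  have hi2 := hcg.integrable_diskMeasure
  rw [hFdef, lintegral_indicator hDm,
    ← ofReal_integral_eq_lintegral_ofReal hi1 (Filter.Eventually.of_forall fun _ => by positivity),
    ← ofReal_integral_eq_lintegral_ofReal hi2 (Filter.Eventually.of_forall fun _ =>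
      gradSq_nonneg _ _)] at hle2
  have h16 : (16 : ENNReal) = ENNReal.ofReal 16 := by norm_num
  have hg0 : 0 ≤ ∫ z, gradSq φ z ∂diskMeasure := integral_nonneg fun _ => gradSq_nonneg _ _
  rw [h16, ← ENNReal.ofReal_mul (by norm_num),
    ENNReal.ofReal_le_ofReal_iff (by positivity)] at hle2
  exact hle2

/-- The Poincaré inequality on the disk and on its boundary. -/
theorem exists_integral_norm_sub_sq_le_disk_circle {φ : ℂ → ℂ} (hφ : ContDiff ℝ 1 φ) :
    ∃ a : ℂ, ∫ z, ‖φ z - a‖ ^ 2 ∂diskMeasure ≤ 16 * ∫ z, gradSq φ z ∂diskMeasure ∧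
      ∫ z, ‖φ z - a‖ ^ 2 ∂circleMeasure ≤ 65 * ∫ z, gradSq φ z ∂diskMeasure := by
  obtain ⟨a, ha⟩ := exists_integral_norm_sub_sq_le hφ
  refine ⟨a, ha, ?_⟩
  have h := integral_circle_norm_sq_le (φ := fun z => φ z - a) (hφ.sub contDiff_const)
  have e : gradSq (fun z => φ z - a) = gradSq φ := by
    funext z
    simp only [gradSq, fderiv_sub_const]
  rw [e] at h
  -- `65 = 4 * 16 + 1`.
  linarith

/-! ### Sobolev functions as limits of smooth triples (function, gradient, trace). -/

theorem Continuous.memLp_diskMeasure {f : ℂ → ℂ} (hf : Continuous f) : MemLp f 2 diskMeasure := by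
  obtain ⟨C, hC⟩ := (isCompact_closedBall (0 : ℂ) 1).exists_bound_of_continuousOn hf.continuousOn
  refine MemLp.of_bound hf.aestronglyMeasurable C ?_
  filter_upwards [ae_restrict_mem measurableSet_ball] with z hz
  exact hC z (Metric.ball_subset_closedBall hz)

theorem Continuous.memLp_circleMeasure {f : ℂ → ℂ} (hf : Continuous f) :
    MemLp f 2 circleMeasure := by
  obtain ⟨C, hC⟩ := (isCompact_closedBall (0 : ℂ) 1).exists_bound_of_continuousOn hf.continuousOn
  refine MemLp.of_bound hf.aestronglyMeasurable C ?_
  filter_upwards [ae_norm_eq_one_circleMeasure] with z hz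
  exact hC z (by simp [hz])

theorem norm_sq_eq_integral_norm_sq {α : Type*} [MeasurableSpace α] {μ : Measure α}
    (w : Lp ℂ 2 μ) : ‖w‖ ^ 2 = ∫ z, ‖w z‖ ^ 2 ∂μ := by
  have h : ((‖w‖ : ℂ)) ^ 2 = inner ℂ w w := (inner_self_eq_norm_sq_to_K (𝕜 := ℂ) w).symm
  rw [L2.inner_def] at h
  have h2 : ∀ z, inner ℂ (w z) (w z) = ((‖w z‖ ^ 2 : ℝ) : ℂ) := fun z => by
    rw [inner_self_eq_norm_sq_to_K]; push_cast; rfl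
  simp only [h2] at h
  rw [integral_complex_ofReal] at h
  exact_mod_cast h

/-- The space of square integrable vector fields on the disk. -/
abbrev GradSpace : Type := PiLp 2 (fun _ : Fin 2 => L2Disk)

/-- Triples consisting of a function on the disk, a vector field, and a boundary function. -/
abbrev TripleSpace : Type := L2Disk × GradSpace × L2Circle

/-- The triple consists of a smooth function, its gradient and its restriction to the circle. -/
def IsSmoothTriple (φ : ℂ → ℂ) (w : TripleSpace) : Prop :=
  ContDiff ℝ ∞ φ ∧ w.1 =ᵐ[diskMeasure] φ ∧
    (∀ j, w.2.1 j =ᵐ[diskMeasure] fun z => fderiv ℝ φ z (coordDir j)) ∧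
    w.2.2 =ᵐ[circleMeasure] φ

theorem continuous_fderiv_apply {φ : ℂ → ℂ} (hφ : ContDiff ℝ ∞ φ) (v : ℂ) :
    Continuous fun z => fderiv ℝ φ z v := by
  have : Continuous fun z => fderiv ℝ φ z := hφ.continuous_fderiv (by simp)
  fun_prop

/-- The triple of a smooth function. -/
def smoothTriple (φ : ℂ → ℂ) (hφ : ContDiff ℝ ∞ φ) : TripleSpace :=
  ((hφ.continuous.memLp_diskMeasure).toLp φ,
    WithLp.toLp 2 fun j => ((continuous_fderiv_apply hφ (coordDir j)).memLp_diskMeasure).toLp _,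
    (hφ.continuous.memLp_circleMeasure).toLp φ)

theorem isSmoothTriple_smoothTriple (φ : ℂ → ℂ) (hφ : ContDiff ℝ ∞ φ) :
    IsSmoothTriple φ (smoothTriple φ hφ) :=
  ⟨hφ, MemLp.coeFn_toLp hφ.continuous.memLp_diskMeasure,
    fun j => MemLp.coeFn_toLp (continuous_fderiv_apply hφ (coordDir j)).memLp_diskMeasure,
    MemLp.coeFn_toLp hφ.continuous.memLp_circleMeasure⟩

theorem IsSmoothTriple.add {φ ψ : ℂ → ℂ} {v w : TripleSpace} (hv : IsSmoothTriple φ v)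
    (hw : IsSmoothTriple ψ w) : IsSmoothTriple (fun z => φ z + ψ z) (v + w) := by
  obtain ⟨h1, h2, h3, h4⟩ := hv
  obtain ⟨k1, k2, k3, k4⟩ := hw
  refine ⟨h1.add k1, ?_, fun j => ?_, ?_⟩
  · filter_upwards [h2, k2, Lp.coeFn_add v.1 w.1] with z e1 e2 e3
    rw [Prod.fst_add, e3, Pi.add_apply, e1, e2]
  · filter_upwards [h3 j, k3 j, Lp.coeFn_add (v.2.1 j) (w.2.1 j)] with z e1 e2 e3
    rw [Prod.snd_add, Prod.fst_add, PiLp.add_apply, e3, Pi.add_apply, e1, e2,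
      fderiv_fun_add (h1.differentiable (by simp) z) (k1.differentiable (by simp) z), add_apply]
  · filter_upwards [h4, k4, Lp.coeFn_add v.2.2 w.2.2] with z e1 e2 e3
    rw [Prod.snd_add, Prod.snd_add, e3, Pi.add_apply, e1, e2]

theorem IsSmoothTriple.smul {φ : ℂ → ℂ} {v : TripleSpace} (c : ℂ) (hv : IsSmoothTriple φ v) :
    IsSmoothTriple (fun z => c * φ z) (c • v) := by
  obtain ⟨h1, h2, h3, h4⟩ := hv
  refine ⟨contDiff_const.mul h1, ?_, fun j => ?_, ?_⟩
  · filter_upwards [h2, Lp.coeFn_smul c v.1] with z e1 e3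
    rw [Prod.smul_fst, e3, Pi.smul_apply, e1, smul_eq_mul]
  · filter_upwards [h3 j, Lp.coeFn_smul c (v.2.1 j)] with z e1 e3
    rw [Prod.smul_snd, Prod.smul_fst, PiLp.smul_apply, e3, Pi.smul_apply, e1,
      fderiv_const_mul (h1.differentiable (by simp) z), smul_apply]
  · filter_upwards [h4, Lp.coeFn_smul c v.2.2] with z e1 e3
    rw [Prod.smul_snd, Prod.smul_snd, e3, Pi.smul_apply, e1, smul_eq_mul]

/-- The submodule of triples of smooth functions. -/
def smoothTriples : Submodule ℂ TripleSpace where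
  carrier := {w | ∃ φ, IsSmoothTriple φ w}
  add_mem' := by
    rintro v w ⟨φ, hφ⟩ ⟨ψ, hψ⟩
    exact ⟨_, hφ.add hψ⟩
  zero_mem' := by
    refine ⟨fun z => 0 * 0, ?_⟩
    have := (isSmoothTriple_smoothTriple (fun _ => 0) contDiff_const).smul 0
    rwa [zero_smul] at this
  smul_mem' := by
    rintro c w ⟨φ, hφ⟩
    exact ⟨_, hφ.smul c⟩

/-- The triples of functions in `H¹` with their gradients and traces. -/
def sobolevTriples : Submodule ℂ TripleSpace := smoothTriples.topologicalClosure

theorem smoothTriple_mem (φ : ℂ → ℂ) (hφ : ContDiff ℝ ∞ φ) :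
    smoothTriple φ hφ ∈ sobolevTriples :=
  Submodule.le_topologicalClosure _ ⟨φ, isSmoothTriple_smoothTriple φ hφ⟩

theorem tendsto_Lp_iff_of_ae_eq {α : Type*} [MeasurableSpace α] {μ : Measure α}
    (w : ℕ → Lp ℂ 2 μ) (φ : ℕ → α → ℂ) (h : ∀ k, w k =ᵐ[μ] φ k) (u : Lp ℂ 2 μ) :
    Filter.Tendsto w Filter.atTop (nhds u) ↔
      Filter.Tendsto (fun k => eLpNorm (fun z => φ k z - u z) 2 μ) Filter.atTop (nhds 0) := by
  rw [Lp.tendsto_Lp_iff_tendsto_eLpNorm']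
  have e : ∀ k, eLpNorm (⇑(w k) - ⇑u) 2 μ = eLpNorm (fun z => φ k z - u z) 2 μ := by
    intro k
    refine eLpNorm_congr_ae ?_
    filter_upwards [h k] with z hz
    rw [Pi.sub_apply, hz]
  simp only [e]

theorem tendsto_tripleSpace_iff (w : ℕ → TripleSpace) (u : TripleSpace) :
    Filter.Tendsto w Filter.atTop (nhds u) ↔
      Filter.Tendsto (fun k => (w k).1) Filter.atTop (nhds u.1) ∧
      (∀ j, Filter.Tendsto (fun k => (w k).2.1 j) Filter.atTop (nhds (u.2.1 j))) ∧
      Filter.Tendsto (fun k => (w k).2.2) Filter.atTop (nhds u.2.2) := by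
  rw [Prod.tendsto_iff, Prod.tendsto_iff, (PiLp.homeomorph 2 _).isInducing.tendsto_nhds_iff,
    tendsto_pi_nhds]
  rfl

/-- The approximating sequence in `HasTrace` is exactly a convergent sequence of smooth triples in
the product space. Statements about functions with a trace become statements about a closed
subspace, and closed conditions need checking on smooth functions only. -/
theorem hasTrace_iff (u : H1Disk) (h : L2Circle) :
    HasTrace u h ↔ ((u.toL2, WithLp.toLp 2 u.grad, h) : TripleSpace) ∈ sobolevTriples := by
  constructor
  · rintro ⟨φ, hφ, h1, h2, h3⟩
    refine mem_closure_of_tendsto (f := fun k => smoothTriple (φ k) (hφ k)) (b := Filter.atTop) ?_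
      (Filter.Eventually.of_forall fun k => ⟨φ k, isSmoothTriple_smoothTriple _ _⟩)
    rw [tendsto_tripleSpace_iff]
    have hs := fun k => isSmoothTriple_smoothTriple (φ k) (hφ k)
    refine ⟨?_, fun j => ?_, ?_⟩
    · exact (tendsto_Lp_iff_of_ae_eq _ φ (fun k => (hs k).2.1) _).2 h1
    · exact (tendsto_Lp_iff_of_ae_eq _ _ (fun k => (hs k).2.2.1 j) _).2 (h2 j)
    · exact (tendsto_Lp_iff_of_ae_eq _ φ (fun k => (hs k).2.2.2) _).2 h3
  · intro hmem
    obtain ⟨w, hw, hlim⟩ := mem_closure_iff_seq_limit.1 hmem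
    choose φ hφ using hw
    rw [tendsto_tripleSpace_iff] at hlim
    obtain ⟨h1, h2, h3⟩ := hlim
    refine ⟨φ, fun k => (hφ k).1, ?_, fun j => ?_, ?_⟩
    · exact (tendsto_Lp_iff_of_ae_eq _ φ (fun k => (hφ k).2.1) _).1 h1
    · exact (tendsto_Lp_iff_of_ae_eq _ _ (fun k => (hφ k).2.2.1 j) _).1 (h2 j)
    · exact (tendsto_Lp_iff_of_ae_eq _ φ (fun k => (hφ k).2.2.2) _).1 h3

theorem continuous_integral_mul {α : Type*} [MeasurableSpace α] {μ : Measure α} {ψ : α → ℂ}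
    (hψ : MemLp ψ 2 μ) : Continuous fun w : Lp ℂ 2 μ => ∫ z, w z * ψ z ∂μ := by
  have e : ∀ w : Lp ℂ 2 μ, ∫ z, w z * ψ z ∂μ = inner ℂ (hψ.star.toLp _) w := by
    intro w
    rw [L2.inner_def]
    refine integral_congr_ae ?_
    filter_upwards [hψ.star.coeFn_toLp] with z hz
    rw [hz]
    simp
  simp only [e]
  fun_prop

theorem integral_mul_fderiv_disk {f φ : ℂ → ℂ} (hf : ContDiff ℝ ∞ f) (hφ : ContDiff ℝ ∞ φ)
    (hc : HasCompactSupport φ) (hs : tsupport φ ⊆ Metric.ball (0 : ℂ) 1) (v : ℂ) :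
    ∫ z, f z * fderiv ℝ φ z v ∂diskMeasure = - ∫ z, fderiv ℝ f z v * φ z ∂diskMeasure := by
  have h0 : ∀ z ∉ Metric.ball (0 : ℂ) 1, φ z = 0 := fun z hz =>
    image_eq_zero_of_notMem_tsupport fun h => hz (hs h)
  have h1 : ∀ z ∉ Metric.ball (0 : ℂ) 1, fderiv ℝ φ z = 0 := fun z hz =>
    image_eq_zero_of_notMem_tsupport fun h => hz (hs (tsupport_fderiv_subset ℝ h))
  rw [setIntegral_eq_integral_of_forall_compl_eq_zero fun z hz => by rw [h1 z hz]; simp,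
    setIntegral_eq_integral_of_forall_compl_eq_zero fun z hz => by rw [h0 z hz]; simp]
  have hcf := hf.continuous
  have hcφ := hφ.continuous
  have hcf' := continuous_fderiv_apply hf v
  have hcφ' := continuous_fderiv_apply hφ v
  refine integral_mul_fderiv_eq_neg_fderiv_mul_of_integrable ?_ ?_ ?_
    (fun x _ => hf.differentiable (by simp) x) (fun x _ => hφ.differentiable (by simp) x)
  · exact (hcf'.mul hcφ).integrable_of_hasCompactSupport hc.mul_left
  · exact (hcf.mul hcφ').integrable_of_hasCompactSupport (hc.fderiv_apply ℝ v).mul_left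
  · exact (hcf.mul hcφ).integrable_of_hasCompactSupport hc.mul_left

/-- Every Sobolev triple comes from a function in `H¹`. -/
theorem exists_h1Disk {w : TripleSpace} (hw : w ∈ sobolevTriples) :
    ∃ u : H1Disk, u.toL2 = w.1 ∧ WithLp.toLp 2 u.grad = w.2.1 ∧ HasTrace u w.2.2 := by
  have hweak : ∀ φ : ℂ → ℂ, ContDiff ℝ ∞ φ → HasCompactSupport φ →
      tsupport φ ⊆ Metric.ball (0 : ℂ) 1 → ∀ j : Fin 2,
      ∫ z, w.1 z * fderiv ℝ φ z (coordDir j) ∂diskMeasure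
        = - ∫ z, w.2.1 j z * φ z ∂diskMeasure := by
    intro φ hφ hc hs j
    -- For a fixed test function, integration by parts is a closed condition on the triple, so it
    -- passes from smooth functions to limits.
    have hcl : IsClosed {w : TripleSpace | ∫ z, w.1 z * fderiv ℝ φ z (coordDir j) ∂diskMeasure
        = - ∫ z, w.2.1 j z * φ z ∂diskMeasure} := by
      refine isClosed_eq ?_ ?_
      · exact (continuous_integral_mul
          (continuous_fderiv_apply hφ (coordDir j)).memLp_diskMeasure).comp continuous_fst
      · have hpr : Continuous fun w : TripleSpace => w.2.1 j := by fun_prop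
        exact ((continuous_integral_mul hφ.continuous.memLp_diskMeasure).comp hpr).neg
    refine closure_minimal ?_ hcl hw
    rintro v ⟨f, hf1, hf2, hf3, hf4⟩
    have e1 : ∫ z, v.1 z * fderiv ℝ φ z (coordDir j) ∂diskMeasure
        = ∫ z, f z * fderiv ℝ φ z (coordDir j) ∂diskMeasure := by
      refine integral_congr_ae ?_
      filter_upwards [hf2] with z hz
      rw [hz]
    have e2 : ∫ z, v.2.1 j z * φ z ∂diskMeasure
        = ∫ z, fderiv ℝ f z (coordDir j) * φ z ∂diskMeasure := by
      refine integral_congr_ae ?_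
      filter_upwards [hf3 j] with z hz
      rw [hz]
    change _ = _
    rw [e1, e2]
    exact integral_mul_fderiv_disk hf1 hφ hc hs _
  refine ⟨⟨w.1, fun j => w.2.1 j, hweak⟩, rfl, rfl, ?_⟩
  rw [hasTrace_iff]
  exact hw

/-! ### Mean-zero traces and the Hilbert space of gradients. -/

theorem circleMeasure_univ : circleMeasure.real Set.univ = 2 * Real.pi := by
  unfold circleMeasure
  rw [map_measureReal_apply measurable_expI MeasurableSet.univ, Set.preimage_univ,
    measureReal_restrict_apply_univ, Real.volume_real_Ioc_of_le (by linarith [Real.pi_pos])]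
  ring

/-- The constant function `1` in `L²` of the circle. -/
def circleOne : L2Circle := (continuous_const (y := (1 : ℂ))).memLp_circleMeasure.toLp _

theorem coeFn_circleOne : circleOne =ᵐ[circleMeasure] fun _ => (1 : ℂ) :=
  MemLp.coeFn_toLp _

theorem inner_circleOne (w : L2Circle) : inner ℂ circleOne w = ∫ z, w z ∂circleMeasure := by
  rw [L2.inner_def]
  refine integral_congr_ae ?_
  filter_upwards [coeFn_circleOne] with z hz
  rw [hz]
  simp

/-- The mean of a function over the circle. -/
def circleMean : L2Circle →L[ℂ] ℂ := ((2 * Real.pi : ℂ)⁻¹) • innerSL ℂ circleOne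

theorem circleMean_apply (w : L2Circle) :
    circleMean w = (2 * Real.pi : ℂ)⁻¹ * ∫ z, w z ∂circleMeasure := by
  rw [← inner_circleOne]; rfl

theorem circleMean_circleOne : circleMean circleOne = 1 := by
  rw [circleMean_apply, integral_congr_ae coeFn_circleOne, integral_const, circleMeasure_univ]
  have : (Real.pi : ℂ) ≠ 0 := by exact_mod_cast Real.pi_ne_zero
  rw [Complex.real_smul]
  push_cast
  field_simp

theorem mem_L2CircleZero_iff (w : L2Circle) : w ∈ L2CircleZero ↔ circleMean w = 0 := by
  have : (Real.pi : ℂ) ≠ 0 := by exact_mod_cast Real.pi_ne_zero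
  rw [circleMean_apply, mul_eq_zero, or_iff_right (by simp [this])]
  rfl

theorem isClosed_L2CircleZero : IsClosed (L2CircleZero : Set L2Circle) := by
  have e : (L2CircleZero : Set L2Circle) = {w | circleMean w = 0} := by
    ext w; exact mem_L2CircleZero_iff w
  rw [e]
  exact isClosed_eq circleMean.continuous continuous_const

instance completeSpace_L2CircleZero : CompleteSpace L2CircleZero :=
  isClosed_L2CircleZero.completeSpace_coe

/-- The triple of the constant function `1`. -/
def oneTriple : TripleSpace := smoothTriple (fun _ => 1) contDiff_const

theorem oneTriple_grad : oneTriple.2.1 = 0 := by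
  ext j : 1
  refine Lp.ext ?_
  filter_upwards [(isSmoothTriple_smoothTriple (fun _ => 1) contDiff_const).2.2.1 j,
    Lp.coeFn_zero ℂ 2 diskMeasure] with z h1 h2
  rw [oneTriple, h1, PiLp.zero_apply, h2]
  simp

theorem oneTriple_trace : oneTriple.2.2 = circleOne := rfl

theorem oneTriple_mem : oneTriple ∈ sobolevTriples := smoothTriple_mem _ _

theorem norm_grad_sq_eq {φ : ℂ → ℂ} {w : TripleSpace} (hw : IsSmoothTriple φ w) :
    ‖w.2.1‖ ^ 2 = ∫ z, gradSq φ z ∂diskMeasure := by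
  obtain ⟨h1, h2, h3, h4⟩ := hw
  have hi : ∀ v : ℂ, Integrable (fun z => ‖fderiv ℝ φ z v‖ ^ 2) diskMeasure := fun v =>
    Continuous.integrable_diskMeasure (by have := continuous_fderiv_apply h1 v; fun_prop)
  have e : ∀ j, ‖w.2.1 j‖ ^ 2 = ∫ z, ‖fderiv ℝ φ z (coordDir j)‖ ^ 2 ∂diskMeasure := by
    intro j
    rw [norm_sq_eq_integral_norm_sq]
    refine integral_congr_ae ?_
    filter_upwards [h3 j] with z hz
    rw [hz]
  rw [PiLp.norm_sq_eq_of_L2, Fin.sum_univ_two, e, e, ← integral_add (hi _) (hi _)]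
  rfl

/-- The product norm is a maximum, so `9` suffices: its square exceeds both `16` and `65`. -/
theorem IsSmoothTriple.exists_norm_sub_le {φ : ℂ → ℂ} {w : TripleSpace}
    (hw : IsSmoothTriple φ w) : ∃ a : ℂ, ‖w - a • oneTriple‖ ≤ 9 * ‖w.2.1‖ := by
  obtain ⟨a, ha1, ha2⟩ := exists_integral_norm_sub_sq_le_disk_circle (hw.1.of_le (by simp))
  refine ⟨a, ?_⟩
  rw [← norm_grad_sq_eq hw] at ha1 ha2
  have h := hw.add ((isSmoothTriple_smoothTriple (fun _ => 1) contDiff_const).smul (-a))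
  change IsSmoothTriple _ (w + (-a) • oneTriple) at h
  rw [neg_smul, ← sub_eq_add_neg] at h
  have e1 : ‖(w - a • oneTriple).1‖ ^ 2 = ∫ z, ‖φ z - a‖ ^ 2 ∂diskMeasure := by
    rw [norm_sq_eq_integral_norm_sq]
    refine integral_congr_ae ?_
    filter_upwards [h.2.1] with z hz
    rw [hz, mul_one, ← sub_eq_add_neg]
  have e2 : ‖(w - a • oneTriple).2.2‖ ^ 2 = ∫ z, ‖φ z - a‖ ^ 2 ∂circleMeasure := by
    rw [norm_sq_eq_integral_norm_sq]
    refine integral_congr_ae ?_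
    filter_upwards [h.2.2.2] with z hz
    rw [hz, mul_one, ← sub_eq_add_neg]
  have hg : (w - a • oneTriple).2.1 = w.2.1 := by
    rw [Prod.snd_sub, Prod.fst_sub, Prod.smul_snd, Prod.smul_fst, oneTriple_grad, smul_zero,
      sub_zero]
  have hn := norm_nonneg w.2.1
  rw [Prod.norm_def, Prod.norm_def, hg]
  refine max_le ?_ (max_le (by linarith) ?_)
  · refine le_of_sq_le_sq ?_ (by positivity)
    nlinarith
  · refine le_of_sq_le_sq ?_ (by positivity)
    nlinarith

/-- The Poincaré inequality for Sobolev triples. -/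
theorem exists_norm_sub_mean_le : ∃ K : ℝ, 0 ≤ K ∧ ∀ w ∈ sobolevTriples,
    ‖w - circleMean w.2.2 • oneTriple‖ ≤ K * ‖w.2.1‖ := by
  refine ⟨9 * (1 + ‖circleMean‖ * ‖oneTriple‖), by positivity, ?_⟩
  intro w hw
  have hcl : IsClosed {w : TripleSpace | ‖w - circleMean w.2.2 • oneTriple‖
      ≤ 9 * (1 + ‖circleMean‖ * ‖oneTriple‖) * ‖w.2.1‖} := by
    refine isClosed_le ?_ ?_ <;> fun_prop
  refine closure_minimal ?_ hcl hw
  rintro v ⟨φ, hφ⟩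
  obtain ⟨a, ha⟩ := hφ.exists_norm_sub_le
  have hmean : circleMean v.2.2 - a = circleMean (v - a • oneTriple).2.2 := by
    rw [Prod.snd_sub, Prod.snd_sub, Prod.smul_snd, Prod.smul_snd, map_sub, map_smul,
      oneTriple_trace, circleMean_circleOne, smul_eq_mul, mul_one]
  -- The circle mean fixes constants, so replacing `a` by the mean costs only the bounded operator
  -- `w ↦ w - mean(w) • 1`.
  have e : v - circleMean v.2.2 • oneTriple
      = (v - a • oneTriple) - circleMean (v - a • oneTriple).2.2 • oneTriple := by
    rw [← hmean, sub_smul]; abel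
  change ‖_‖ ≤ _
  rw [e]
  calc _ ≤ ‖v - a • oneTriple‖ + ‖circleMean (v - a • oneTriple).2.2 • oneTriple‖ := norm_sub_le _ _
    _ ≤ ‖v - a • oneTriple‖ + ‖circleMean‖ * ‖v - a • oneTriple‖ * ‖oneTriple‖ := by
        rw [norm_smul]
        gcongr
        refine (circleMean.le_opNorm _).trans ?_
        gcongr
        exact (norm_snd_le _).trans (norm_snd_le _)
    _ = (1 + ‖circleMean‖ * ‖oneTriple‖) * ‖v - a • oneTriple‖ := by ring
    _ ≤ (1 + ‖circleMean‖ * ‖oneTriple‖) * (9 * ‖v.2.1‖) := by gcongr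
    _ = _ := by ring

/-- The Sobolev triples with mean-zero trace. -/
def meanZeroTriples : Submodule ℂ TripleSpace :=
  sobolevTriples ⊓ Submodule.comap
    ((ContinuousLinearMap.snd ℂ GradSpace L2Circle).comp
      (ContinuousLinearMap.snd ℂ L2Disk (GradSpace × L2Circle))).toLinearMap L2CircleZero

theorem isClosed_meanZeroTriples : IsClosed (meanZeroTriples : Set TripleSpace) :=
  (Submodule.isClosed_topologicalClosure _).inter
    (isClosed_L2CircleZero.preimage (continuous_snd.comp continuous_snd))

instance completeSpace_meanZeroTriples : CompleteSpace meanZeroTriples :=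
  isClosed_meanZeroTriples.completeSpace_coe

/-- The gradient, on the triples with mean-zero trace. -/
def gradMap : meanZeroTriples →L[ℂ] GradSpace :=
  ((ContinuousLinearMap.fst ℂ GradSpace L2Circle).comp
    (ContinuousLinearMap.snd ℂ L2Disk (GradSpace × L2Circle))).comp meanZeroTriples.subtypeL

/-- For mean-zero traces the constant subtracted in the Poincaré inequality is zero. Injectivity and
closed range of `gradMap` follow, which make the trace a bounded function of the gradient. -/
theorem exists_antilipschitzWith_gradMap : ∃ K, AntilipschitzWith K gradMap := by
  obtain ⟨K, hK, h⟩ := exists_norm_sub_mean_le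
  refine ⟨⟨K, hK⟩, ContinuousLinearMap.antilipschitz_of_bound gradMap fun w => ?_⟩
  have hw := h w w.2.1
  have h0 : circleMean (w : TripleSpace).2.2 = 0 := (mem_L2CircleZero_iff _).1 w.2.2
  rw [h0, zero_smul, sub_zero] at hw
  exact hw

theorem gradMap_injective : Function.Injective gradMap :=
  exists_antilipschitzWith_gradMap.choose_spec.injective

theorem isClosed_range_gradMap : IsClosed (Set.range gradMap) :=
  exists_antilipschitzWith_gradMap.choose_spec.isClosed_range gradMap.uniformContinuous

/-- The closed space of gradients of functions in `H¹`. -/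
abbrev gradients : Submodule ℂ GradSpace := gradMap.range

instance completeSpace_gradients : CompleteSpace gradients := by
  have h : IsClosed (gradients : Set GradSpace) := by
    rw [LinearMap.coe_range]; exact isClosed_range_gradMap
  exact h.completeSpace_coe

/-- The mean-zero trace of the function with a given gradient. -/
def gradTrace : gradients →L[ℂ] L2CircleZero :=
  (((((ContinuousLinearMap.snd ℂ GradSpace L2Circle).comp
    (ContinuousLinearMap.snd ℂ L2Disk (GradSpace × L2Circle))).comp
      meanZeroTriples.subtypeL).codRestrict L2CircleZero fun w => w.2.2)).comp
    (gradMap.equivRange gradMap_injective isClosed_range_gradMap).symm.toContinuousLinearMap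

theorem exists_gradients_of_mem {w : TripleSpace} (hw : w ∈ meanZeroTriples) :
    ∃ x : gradients, (x : GradSpace) = w.2.1 ∧ (gradTrace x : L2Circle) = w.2.2 := by
  refine ⟨gradMap.equivRange gradMap_injective isClosed_range_gradMap ⟨w, hw⟩, ?_, ?_⟩
  · rw [ContinuousLinearMap.coe_equivRange]; rfl
  · simp only [gradTrace, ContinuousLinearMap.comp_apply, ContinuousLinearEquiv.coe_coe,
      ContinuousLinearEquiv.symm_apply_apply]
    rfl

theorem exists_mem_of_gradients (x : gradients) :
    ∃ w ∈ meanZeroTriples, (x : GradSpace) = w.2.1 ∧ (gradTrace x : L2Circle) = w.2.2 := by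
  obtain ⟨v, hv⟩ := x.2
  obtain ⟨y, hy1, hy2⟩ := exists_gradients_of_mem v.2
  have : x = y := Subtype.ext (by rw [hy1, ← hv]; rfl)
  exact ⟨v, v.2, this ▸ hy1, this ▸ hy2⟩

/-- Subtracting a constant leaves the gradient unchanged and makes the trace mean-zero, so arbitrary
test functions reduce to `gradients`. -/
theorem exists_gradients_of_mem_sobolevTriples {w : TripleSpace} (hw : w ∈ sobolevTriples) :
    ∃ x : gradients, (x : GradSpace) = w.2.1 ∧
      w.2.2 = gradTrace x + circleMean w.2.2 • circleOne := by
  have hmem : w - circleMean w.2.2 • oneTriple ∈ meanZeroTriples := by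
    refine ⟨sobolevTriples.sub_mem hw (sobolevTriples.smul_mem _ oneTriple_mem), ?_⟩
    change w.2.2 - circleMean w.2.2 • circleOne ∈ L2CircleZero
    rw [mem_L2CircleZero_iff, map_sub, map_smul, circleMean_circleOne, smul_eq_mul, mul_one,
      sub_self]
  obtain ⟨x, hx1, hx2⟩ := exists_gradients_of_mem hmem
  refine ⟨x, ?_, ?_⟩
  · rw [hx1, Prod.snd_sub, Prod.fst_sub, Prod.smul_snd, Prod.smul_fst, oneTriple_grad, smul_zero,
      sub_zero]
  · rw [hx2, Prod.snd_sub, Prod.snd_sub, Prod.smul_snd, Prod.smul_snd, oneTriple_trace,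
      sub_add_cancel]

theorem HasTrace.exists_gradients {u : H1Disk} {k : L2Circle} (h : HasTrace u k) :
    ∃ x : gradients, (x : GradSpace) = WithLp.toLp 2 u.grad ∧
      k = gradTrace x + circleMean k • circleOne :=
  exists_gradients_of_mem_sobolevTriples ((hasTrace_iff u k).1 h)

theorem exists_h1Disk_of_gradients (x : gradients) :
    ∃ u : H1Disk, WithLp.toLp 2 u.grad = (x : GradSpace) ∧ HasTrace u (gradTrace x) := by
  obtain ⟨w, hw, h1, h2⟩ := exists_mem_of_gradients x
  obtain ⟨u, -, h4, h5⟩ := exists_h1Disk hw.1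
  exact ⟨u, h4.trans h1.symm, h2 ▸ h5⟩

/-! ### Differentiating a compressed inverse. -/

section Abstract

variable {A X Y Z : Type*} [NormedAddCommGroup A] [NormedSpace ℝ A]
  [NormedAddCommGroup X] [InnerProductSpace ℂ X] [CompleteSpace X]
  [NormedAddCommGroup Y] [InnerProductSpace ℂ Y] [CompleteSpace Y]
  [NormedAddCommGroup Z] [NormedSpace ℂ Z]

/-- The family of operators `∑ j, (P j)† M(a) P j`. -/
def compressionSum (M : A →L[ℝ] (Y →L[ℂ] Y)) (P : Fin 2 → X →L[ℂ] Y) :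
    A →L[ℝ] (X →L[ℂ] X) :=
  ∑ j : Fin 2, ((((ContinuousLinearMap.compL ℂ X Y X (ContinuousLinearMap.adjoint (P j))).comp
    ((ContinuousLinearMap.compL ℂ X Y Y).flip (P j)))).restrictScalars ℝ).comp M

theorem inner_compressionSum (M : A →L[ℝ] (Y →L[ℂ] Y)) (P : Fin 2 → X →L[ℂ] Y) (a : A)
    (x y : X) :
    inner ℂ y (compressionSum M P a x) = ∑ j : Fin 2, inner ℂ (P j y) (M a (P j x)) := by
  simp only [compressionSum, sum_apply, inner_sum]
  exact Finset.sum_congr rfl fun j _ => ContinuousLinearMap.adjoint_inner_right (P j) y _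

/-- At the identity, inversion has derivative `h ↦ -h`; the maps before and after it are linear. -/
theorem hasFDerivAt_comp_inverse_comp (B : A →L[ℝ] (X →L[ℂ] X)) (T : X →L[ℂ] Z)
    (S : Z →L[ℂ] X) {a : A} (ha : B a = 1) :
    ∃ L : A →L[ℝ] (Z →L[ℂ] Z),
      HasFDerivAt (fun γ => T.comp ((Ring.inverse (B γ)).comp S)) L a ∧
        ∀ η, L η = -(T.comp ((B η).comp S)) := by
  have hinv : HasFDerivAt (𝕜 := ℝ) (Ring.inverse : (X →L[ℂ] X) → (X →L[ℂ] X))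
      (-ContinuousLinearMap.mulLeftRight ℝ (X →L[ℂ] X) 1 1) (B a) := by
    rw [ha]
    simpa using hasFDerivAt_ringInverse (𝕜 := ℝ) (1 : (X →L[ℂ] X)ˣ)
  let Ψ : (X →L[ℂ] X) →L[ℝ] (Z →L[ℂ] Z) :=
    ((ContinuousLinearMap.compL ℂ Z X Z T).comp
      ((ContinuousLinearMap.compL ℂ Z X X).flip S)).restrictScalars ℝ
  have h2 := Ψ.hasFDerivAt.comp a (hinv.comp a B.hasFDerivAt)
  refine ⟨_, h2, fun η => ?_⟩
  ext1 g
  simp [Ψ]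

theorem HasFDerivAt.fderiv_clm {f : A → (Z →L[ℂ] Z)} {L : A →L[ℝ] (Z →L[ℂ] Z)} {a : A}
    (h : HasFDerivAt f L a) : fderiv ℝ f a = L :=
  h.fderiv

end Abstract

/-! ### The conductivity operator and the Neumann-to-Dirichlet map. -/

/-- Multiplication by a bounded real function, as an operator on `L²(𝔻)`. -/
def mulOp : LInfDisk →L[ℝ] (L2Disk →L[ℂ] L2Disk) :=
  (((ContinuousLinearMap.mul ℂ ℂ).holderL diskMeasure ⊤ 2 2).restrictScalars ℝ).comp
    (Complex.ofRealCLM.compLpL ⊤ diskMeasure)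

theorem coeFn_mulOp (γ : LInfDisk) (w : L2Disk) :
    mulOp γ w =ᵐ[diskMeasure] fun z => (γ z : ℂ) * w z := by
  have h : mulOp γ w = (ContinuousLinearMap.mul ℂ ℂ).holder 2
      (Complex.ofRealCLM.compLpL ⊤ diskMeasure γ) w := rfl
  rw [h]
  filter_upwards [ContinuousLinearMap.coeFn_holder (r := 2) (ContinuousLinearMap.mul ℂ ℂ)
    (Complex.ofRealCLM.compLpL ⊤ diskMeasure γ) w,
    ContinuousLinearMap.coeFn_compLpL Complex.ofRealCLM γ] with z h1 h2
  rw [h1, h2]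
  simp

/-- A component of a gradient. -/
def gradComp (j : Fin 2) : gradients →L[ℂ] L2Disk :=
  (PiLp.proj 2 (fun _ : Fin 2 => L2Disk) j).comp gradients.subtypeL

/-- The operator on gradients that represents the form `∫ γ ∇u · conj ∇v`. -/
def conductivityOp : LInfDisk →L[ℝ] (gradients →L[ℂ] gradients) :=
  compressionSum mulOp gradComp

theorem inner_conductivityOp_eq_sum (γ : LInfDisk) (x y : gradients) :
    inner ℂ y (conductivityOp γ x)
      = ∑ j : Fin 2, inner ℂ ((y : GradSpace) j) (mulOp γ ((x : GradSpace) j)) :=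
  inner_compressionSum mulOp gradComp γ x y

theorem inner_mulOp (γ : LInfDisk) (v w : L2Disk) :
    inner ℂ v (mulOp γ w) = ∫ z, (γ z : ℂ) * (w z * starRingEnd ℂ (v z)) ∂diskMeasure := by
  rw [L2.inner_def]
  refine integral_congr_ae ?_
  filter_upwards [coeFn_mulOp γ w] with z hz
  rw [hz, RCLike.inner_apply, mul_assoc]

theorem integrable_mul_mul_conj (γ : LInfDisk) (v w : L2Disk) :
    Integrable (fun z => (γ z : ℂ) * (w z * starRingEnd ℂ (v z))) diskMeasure := by
  refine (L2.integrable_inner (𝕜 := ℂ) v (mulOp γ w)).congr ?_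
  filter_upwards [coeFn_mulOp γ w] with z hz
  rw [hz, RCLike.inner_apply, mul_assoc]

theorem inner_conductivityOp (γ : LInfDisk) (x y : gradients) :
    inner ℂ y (conductivityOp γ x)
      = ∫ z, (γ z : ℂ) * ∑ j : Fin 2, (x : GradSpace) j z *
          starRingEnd ℂ ((y : GradSpace) j z) ∂diskMeasure := by
  rw [inner_conductivityOp_eq_sum]
  simp only [Finset.mul_sum, inner_mulOp]
  rw [integral_finsetSum]
  exact fun j _ => integrable_mul_mul_conj _ _ _

/-- The components of a gradient together form the isometric inclusion into `GradSpace`, so the sum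
of `(P j)† P j` is the identity. -/
theorem conductivityOp_unit : conductivityOp unitConductivity = 1 := by
  ext1 x
  refine ext_inner_left ℂ fun y => ?_
  rw [inner_conductivityOp_eq_sum, one_apply_eq_self, Submodule.coe_inner, PiLp.inner_apply]
  refine Finset.sum_congr rfl fun j _ => ?_
  congr 1
  refine Lp.ext ?_
  filter_upwards [coeFn_mulOp unitConductivity ((x : GradSpace) j),
    Lp.coeFn_const ⊤ diskMeasure (1 : ℝ)] with z h1 h2
  rw [h1, unitConductivity, h2]
  simp

theorem re_inner_mulOp_ge {γ : LInfDisk} {ε : ℝ} (h : ∀ᵐ z ∂diskMeasure, ε ≤ γ z)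
    (w : L2Disk) : ε * ‖w‖ ^ 2 ≤ (inner ℂ w (mulOp γ w)).re := by
  have e : ∀ z, (γ z : ℂ) * (w z * starRingEnd ℂ (w z)) = ((γ z * ‖w z‖ ^ 2 : ℝ) : ℂ) := by
    intro z
    rw [Complex.mul_conj, Complex.normSq_eq_norm_sq]; push_cast; rfl
  have hint := (integrable_mul_mul_conj γ w w).re
  simp only [e] at hint
  rw [inner_mulOp, norm_sq_eq_integral_norm_sq]
  simp only [e]
  rw [integral_complex_ofReal, Complex.ofReal_re, ← integral_const_mul]
  refine integral_mono_ae ((Lp.memLp w).integrable_norm_pow (by norm_num) |>.const_mul ε) hint ?_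
  filter_upwards [h] with z hz
  exact mul_le_mul_of_nonneg_right hz (by positivity)

/-- Lax–Milgram: the lower bound `ε` for `γ` is a coercivity constant of the form. -/
theorem isUnit_conductivityOp {γ : LInfDisk} (hγ : γ ∈ LInfPos) : IsUnit (conductivityOp γ) := by
  obtain ⟨ε, hε, h⟩ := hγ
  refine ContinuousLinearMap.isUnit_of_forall_le_norm_inner_map _ (c := ⟨ε, hε.le⟩) hε fun x => ?_
  rw [norm_inner_symm]
  refine le_trans ?_ (Complex.re_le_norm _)
  rw [inner_conductivityOp_eq_sum, Complex.re_sum, Submodule.coe_norm, PiLp.norm_sq_eq_of_L2,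
    Finset.sum_mul]
  refine Finset.sum_le_sum fun j _ => ?_
  rw [mul_comm]
  exact re_inner_mulOp_ge h _

/-- The Neumann-to-Dirichlet operator as a formula. -/
def ndOp (γ : LInfDisk) : L2CircleZero →L[ℂ] L2CircleZero :=
  gradTrace.comp ((Ring.inverse (conductivityOp γ)).comp (ContinuousLinearMap.adjoint gradTrace))

theorem inner_L2Circle (v w : L2Circle) :
    inner ℂ v w = ∫ z, w z * starRingEnd ℂ (v z) ∂circleMeasure := by
  rw [L2.inner_def]
  simp only [RCLike.inner_apply]

theorem inner_adjoint_gradTrace (g : L2CircleZero) (y : gradients) :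
    inner ℂ y (ContinuousLinearMap.adjoint gradTrace g)
      = inner ℂ (gradTrace y : L2Circle) (g : L2Circle) := by
  rw [ContinuousLinearMap.adjoint_inner_right, Submodule.coe_inner]

theorem isWeakSolution_of_conductivityOp_eq {γ : LInfDisk} {g : L2CircleZero} {x : gradients}
    (hx : conductivityOp γ x = ContinuousLinearMap.adjoint gradTrace g) :
    ∃ u : H1Disk, IsWeakSolution γ g u (gradTrace x) := by
  obtain ⟨u, hu1, hu2⟩ := exists_h1Disk_of_gradients x
  refine ⟨u, hu2, fun v k hvk => ?_⟩
  obtain ⟨y, hy1, hy2⟩ := hvk.exists_gradients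
  have h1 := inner_conductivityOp γ x y
  rw [hx, inner_adjoint_gradTrace, ← hu1, hy1] at h1
  -- The constant part of the test trace pairs to zero with the mean-zero datum `g`.
  rw [← inner_L2Circle, hy2, inner_add_left, inner_smul_left, inner_circleOne]
  have hg : ∫ z, (g : L2Circle) z ∂circleMeasure = 0 := g.2
  rw [hg, mul_zero, add_zero]
  exact h1.symm

theorem IsWeakSolution.exists_conductivityOp_eq {γ : LInfDisk} {g h : L2CircleZero} {u : H1Disk}
    (hu : IsWeakSolution γ g u h) :
    ∃ x : gradients, conductivityOp γ x = ContinuousLinearMap.adjoint gradTrace g ∧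
      gradTrace x = h := by
  obtain ⟨hu1, hu2⟩ := hu
  obtain ⟨x, hx1, hx2⟩ := hu1.exists_gradients
  rw [(mem_L2CircleZero_iff _).1 h.2, zero_smul, add_zero] at hx2
  refine ⟨x, ext_inner_left ℂ fun y => ?_, (Subtype.ext hx2).symm⟩
  obtain ⟨v, hv1, hv2⟩ := exists_h1Disk_of_gradients y
  have h2 := hu2 v _ hv2
  rw [inner_conductivityOp, inner_adjoint_gradTrace, inner_L2Circle, ← h2, hx1, ← hv1]

theorem isWeakSolution_iff {γ : LInfDisk} (hγ : γ ∈ LInfPos) (g h : L2CircleZero) :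
    (∃ u : H1Disk, IsWeakSolution γ g u h) ↔ ndOp γ g = h := by
  have hu := isUnit_conductivityOp hγ
  constructor
  · rintro ⟨u, hu'⟩
    obtain ⟨x, hx1, rfl⟩ := hu'.exists_conductivityOp_eq
    change gradTrace (Ring.inverse (conductivityOp γ) (ContinuousLinearMap.adjoint gradTrace g)) = _
    rw [← hx1, ← mul_apply_eq_comp, Ring.inverse_mul_cancel _ hu, one_apply_eq_self]
  · rintro rfl
    refine isWeakSolution_of_conductivityOp_eq
      (x := Ring.inverse (conductivityOp γ) (ContinuousLinearMap.adjoint gradTrace g)) ?_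
    rw [← mul_apply_eq_comp, Ring.mul_inverse_cancel _ hu, one_apply_eq_self]

/-- `ndOp` witnesses the existence clause in the definition of `ndMap`, and uniqueness of the
solution's trace forces the chosen operator to coincide with it. -/
theorem ndMap_eq_ndOp {γ : LInfDisk} (hγ : γ ∈ LInfPos) : ndMap γ = ndOp γ := by
  have hex : γ ∈ LInfPos ∧ ∃ T : L2CircleZero →L[ℂ] L2CircleZero,
      ∀ g : L2CircleZero, ∃ u : H1Disk, IsWeakSolution γ g u (T g) :=
    ⟨hγ, ndOp γ, fun g => (isWeakSolution_iff hγ g _).2 rfl⟩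
  rw [ndMap, dif_pos hex]
  ext1 g
  exact ((isWeakSolution_iff hγ g _).1 (hex.2.choose_spec g)).symm

theorem ndMap_eq_iff {γ : LInfDisk} (hγ : γ ∈ LInfPos) (g h : L2CircleZero) :
    ndMap γ g = h ↔ ∃ u : H1Disk, IsWeakSolution γ g u h := by
  rw [ndMap_eq_ndOp hγ, isWeakSolution_iff hγ]

/-- A perturbation of `1` smaller than `1/2` in the essential supremum norm leaves a conductivity
above `1/2`. Being a neighbourhood, `LInfPos` is large enough that the default value of `ndMap`
outside it does not affect the derivative. -/
theorem LInfPos_mem_nhds_unitConductivity : LInfPos ∈ nhds unitConductivity := by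
  refine Metric.mem_nhds_iff.2 ⟨1 / 2, by norm_num, fun γ hγ => ⟨1 / 2, by norm_num, ?_⟩⟩
  rw [Metric.mem_ball, dist_eq_norm] at hγ
  have h : ∀ᵐ z ∂diskMeasure, ‖(γ - unitConductivity) z‖ ≤ ‖γ - unitConductivity‖ := by
    have h2 := ae_le_eLpNormEssSup (f := ⇑(γ - unitConductivity)) (μ := diskMeasure)
    rw [← eLpNorm_exponent_top, ← Lp.enorm_def] at h2
    filter_upwards [h2] with z hz
    exact enorm_le_iff_norm_le.1 hz
  filter_upwards [h, Lp.coeFn_sub γ unitConductivity,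
    Lp.coeFn_const ⊤ diskMeasure (1 : ℝ)] with z h1 h2 h3
  rw [h2, Pi.sub_apply, unitConductivity, h3, Function.const_apply, Real.norm_eq_abs] at h1
  have := (abs_le.1 (h1.trans hγ.le)).1
  linarith

set_option synthInstance.maxHeartbeats 200000 in
theorem hasFDerivAt_ndMap : ∃ L : LInfDisk →L[ℝ] (L2CircleZero →L[ℂ] L2CircleZero),
    HasFDerivAt ndMap L unitConductivity ∧ ∀ η, L η = -(gradTrace.comp
      ((conductivityOp η).comp (ContinuousLinearMap.adjoint gradTrace))) := by
  obtain ⟨L, hL, hη⟩ := hasFDerivAt_comp_inverse_comp conductivityOp gradTrace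
    (ContinuousLinearMap.adjoint gradTrace) conductivityOp_unit
  refine ⟨L, hL.congr_of_eventuallyEq ?_, hη⟩
  filter_upwards [LInfPos_mem_nhds_unitConductivity] with γ hγ
  exact ndMap_eq_ndOp hγ

-- Moving the outer `gradTrace` to the other side of the inner product leaves the form of `η`
-- evaluated at two adjoint images, which depend on the Neumann data only.
set_option synthInstance.maxHeartbeats 200000 in
theorem ndDerivMatrix_apply (η : LInfDisk) (n m : {n : ℤ // n ≠ 0}) (x y : gradients)
    (hx : ContinuousLinearMap.adjoint gradTrace (trigBasis m) = x)
    (hy : ContinuousLinearMap.adjoint gradTrace (trigBasis n) = y) :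
    ndDerivMatrix η n m = - ∫ z, (η z : ℂ) * ∑ j : Fin 2, (x : GradSpace) j z *
          starRingEnd ℂ ((y : GradSpace) j z) ∂diskMeasure := by
  obtain ⟨L, hL, hη⟩ := hasFDerivAt_ndMap
  have hfd : fderiv ℝ ndMap unitConductivity = L := hL.fderiv_clm
  rw [ndDerivMatrix, hfd, hη, neg_apply, inner_neg_right, ContinuousLinearMap.comp_apply,
    ContinuousLinearMap.comp_apply, ← ContinuousLinearMap.adjoint_inner_left, hx, hy,
    inner_conductivityOp]

/-! ### Moments of monomials on the circle, the disk and off-centre balls. -/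

theorem fderiv_pow_complex_apply (k : ℕ) (z v : ℂ) :
    fderiv ℝ (fun z : ℂ => z ^ k) z v = k * z ^ (k - 1) * v := by
  have h := (hasDerivAt_pow k z).hasFDerivAt.restrictScalars ℝ
  rw [h.fderiv]
  simp
  ring

theorem contDiff_conj {n : ℕ∞ω} : ContDiff ℝ n (fun z : ℂ => starRingEnd ℂ z) :=
  Complex.conjCLE.contDiff

theorem fderiv_conj_comp_apply {φ : ℂ → ℂ} (hφ : Differentiable ℝ φ) (z v : ℂ) :
    fderiv ℝ (fun z => starRingEnd ℂ (φ z)) z v = starRingEnd ℂ (fderiv ℝ φ z v) := by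
  have h : HasFDerivAt (fun z : ℂ => starRingEnd ℂ (φ z))
      ((Complex.conjCLE : ℂ →L[ℝ] ℂ).comp (fderiv ℝ φ z)) z :=
    (Complex.conjCLE.hasFDerivAt (x := φ z)).comp z (hφ z).hasFDerivAt
  rw [h.fderiv]
  rfl

/-- The operator `∂_x + i ∂_y` kills the holomorphic factor `z^k`, so Green's formula for `z^k φ`
differentiates `φ` alone. -/
theorem integral_pow_mul_dbar (k : ℕ) {φ : ℂ → ℂ} (hφ : ContDiff ℝ ∞ φ) :
    ∫ z, z ^ k * (fderiv ℝ φ z 1 + Complex.I * fderiv ℝ φ z Complex.I) ∂diskMeasure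
      = ∫ z, z ^ (k + 1) * φ z ∂circleMeasure := by
  have hpow : ContDiff ℝ ∞ fun z : ℂ => z ^ k := contDiff_id.pow k
  have h := integral_disk_dbar (fun z => z ^ k * φ z) ((hpow.mul hφ).of_le (by simp))
  have e : ∀ z v : ℂ, fderiv ℝ (fun z => z ^ k * φ z) z v
      = z ^ k * fderiv ℝ φ z v + φ z * (k * z ^ (k - 1) * v) := by
    intro z v
    rw [fderiv_fun_mul (hpow.differentiable (by simp) z) (hφ.differentiable (by simp) z),
      ← fderiv_pow_complex_apply]
    simp
  have e2 : ∀ z : ℂ, z * (z ^ k * φ z) = z ^ (k + 1) * φ z := fun z => by ring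
  have e3 : ∀ z, z ^ k * (fderiv ℝ φ z 1 + Complex.I * fderiv ℝ φ z Complex.I)
      = fderiv ℝ (fun z => z ^ k * φ z) z 1
        + Complex.I * fderiv ℝ (fun z => z ^ k * φ z) z Complex.I := by
    intro z
    rw [e, e]
    linear_combination -(φ z * k * z ^ (k - 1)) * Complex.I_sq
  simp only [e3]
  simp only [e2] at h
  exact h

theorem integral_circle_pow_mul_conj_pow (k l : ℕ) :
    ∫ z : ℂ, z ^ k * starRingEnd ℂ z ^ l ∂circleMeasure
      = if k = l then 2 * (Real.pi : ℂ) else 0 := by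
  have e : ∫ z : ℂ, z ^ k * starRingEnd ℂ z ^ l ∂circleMeasure
      = ∫ z : ℂ, z ^ ((k : ℤ) - l) ∂circleMeasure := by
    refine integral_congr_ae ?_
    filter_upwards [ae_norm_eq_one_circleMeasure] with z hz
    have hz0 : z ≠ 0 := by rintro rfl; simp at hz
    have hinv : starRingEnd ℂ z = z⁻¹ := by
      rw [Complex.inv_def, Complex.normSq_eq_norm_sq, hz]; simp
    rw [zpow_sub₀ hz0, zpow_natCast, zpow_natCast, hinv, inv_pow, div_eq_mul_inv]
  rw [e]
  split_ifs with h
  · subst h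
    simp only [sub_self, zpow_zero]
    rw [integral_const, circleMeasure_univ, Complex.real_smul]
    push_cast; ring
  · exact integral_circleMeasure_zpow _ (by omega)

/-- Taking `φ = conj(z)^(l+1)`, for which `(∂_x + i ∂_y) φ = 2 (l+1) conj(z)^l`, reduces the disk
moment to a circle moment. -/
theorem integral_disk_pow_mul_conj_pow (k l : ℕ) :
    ∫ z : ℂ, z ^ k * starRingEnd ℂ z ^ l ∂diskMeasure
      = if k = l then (Real.pi : ℂ) / (k + 1) else 0 := by
  have hpow : ContDiff ℝ ∞ fun z : ℂ => z ^ (l + 1) := contDiff_id.pow _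
  have h := integral_pow_mul_dbar k (φ := fun z => starRingEnd ℂ (z ^ (l + 1)))
    (contDiff_conj.comp hpow)
  have e : ∀ z : ℂ, z ^ k * (fderiv ℝ (fun z => starRingEnd ℂ (z ^ (l + 1))) z 1
      + Complex.I * fderiv ℝ (fun z => starRingEnd ℂ (z ^ (l + 1))) z Complex.I)
      = (2 * (l + 1)) * (z ^ k * starRingEnd ℂ z ^ l) := by
    intro z
    rw [fderiv_conj_comp_apply (hpow.differentiable (by simp)),
      fderiv_conj_comp_apply (hpow.differentiable (by simp)), fderiv_pow_complex_apply,
      fderiv_pow_complex_apply]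
    simp only [map_mul, map_pow, map_natCast, Complex.conj_I, map_one, Nat.add_sub_cancel]
    push_cast
    linear_combination -(z ^ k * (l + 1) * starRingEnd ℂ z ^ l) * Complex.I_sq
  simp only [e] at h
  rw [integral_const_mul] at h
  simp only [map_pow] at h
  rw [integral_circle_pow_mul_conj_pow] at h
  have hl : (l : ℂ) + 1 ≠ 0 := by exact_mod_cast l.succ_ne_zero
  split_ifs with hkl
  · subst hkl
    rw [if_pos rfl] at h
    field_simp
    linear_combination h / 2
  · rw [if_neg (by omega)] at h
    rcases mul_eq_zero.1 h with h | h
    · exact absurd h (mul_ne_zero two_ne_zero hl)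
    · exact h

theorem setIntegral_ball_eq {R : ℝ} (hR : 0 < R) (C : ℂ) (f : ℂ → ℂ) :
    ∫ z in Metric.ball C R, f z = (R : ℂ) ^ 2 * ∫ w, f (C + R * w) ∂diskMeasure := by
  rw [← integral_indicator measurableSet_ball, ← integral_indicator measurableSet_ball,
    ← integral_add_left_eq_self _ C]
  have h := Measure.integral_comp_smul volume
    (fun z : ℂ => (Metric.ball C R).indicator f (C + z)) R
  rw [Complex.finrank_real_complex, abs_of_pos (by positivity), Complex.real_smul] at h
  have e : ∀ w : ℂ, (Metric.ball (0 : ℂ) 1).indicator (fun w => f (C + R * w)) w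
      = (Metric.ball C R).indicator f (C + R • w) := by
    intro w
    classical
    rw [Set.indicator_apply, Set.indicator_apply, Complex.real_smul]
    have : w ∈ Metric.ball (0 : ℂ) 1 ↔ C + R * w ∈ Metric.ball C R := by
      rw [mem_ball_zero_iff, mem_ball_iff_norm, add_sub_cancel_left, norm_mul, Complex.norm_real,
        Real.norm_of_nonneg hR.le]
      constructor
      · intro h; nlinarith
      · intro h; by_contra! h2; nlinarith
    simp only [this]
  simp only [e]
  rw [h, ← mul_assoc]
  have : (R : ℂ) ≠ 0 := by exact_mod_cast hR.ne'
  push_cast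
  rw [mul_inv_cancel₀ (pow_ne_zero 2 this), one_mul]

/-- After `z = C + R w` and binomial expansion, only equal powers of `w` and `conj(w)` survive. The
power of `R` is `2k` from the monomials and `2` from the Jacobian. -/
theorem integral_ball_pow_mul_conj_pow {R : ℝ} (hR : 0 < R) (C : ℂ) (a b : ℕ) :
    ∫ z in Metric.ball C R, z ^ a * starRingEnd ℂ z ^ b
      = ∑ k ∈ Finset.range (min a b + 1), (Real.pi : ℂ) / (k + 1) * (a.choose k) * (b.choose k) *
          (C ^ (a - k) * starRingEnd ℂ C ^ (b - k)) * (R : ℂ) ^ (2 * k + 2) := by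
  rw [setIntegral_ball_eq hR]
  have e : ∀ w : ℂ, (C + R * w) ^ a * starRingEnd ℂ (C + R * w) ^ b
      = ∑ k ∈ Finset.range (a + 1), ∑ l ∈ Finset.range (b + 1),
        (a.choose k * b.choose l * (C ^ (a - k) * starRingEnd ℂ C ^ (b - l)) * (R : ℂ) ^ (k + l)) *
          (w ^ k * starRingEnd ℂ w ^ l) := by
    intro w
    rw [map_add, map_mul, Complex.conj_ofReal, add_comm C, add_comm (starRingEnd ℂ C), add_pow,
      add_pow, Finset.sum_mul_sum]
    refine Finset.sum_congr rfl fun k _ => Finset.sum_congr rfl fun l _ => ?_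
    ring
  simp only [e]
  have hi : ∀ k l : ℕ, Integrable (fun w : ℂ => (a.choose k * b.choose l *
      (C ^ (a - k) * starRingEnd ℂ C ^ (b - l)) * (R : ℂ) ^ (k + l)) *
          (w ^ k * starRingEnd ℂ w ^ l)) diskMeasure := fun k l =>
    Continuous.integrable_diskMeasure
      (by have : Continuous (fun z : ℂ => starRingEnd ℂ z) := Complex.continuous_conj
          fun_prop)
  rw [integral_finsetSum _ fun k _ => integrable_finsetSum _ fun l _ => hi k l]
  have e2 : ∀ k, ∫ w, ∑ l ∈ Finset.range (b + 1),
      (a.choose k * b.choose l * (C ^ (a - k) * starRingEnd ℂ C ^ (b - l)) * (R : ℂ) ^ (k + l)) *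
          (w ^ k * starRingEnd ℂ w ^ l) ∂diskMeasure
      = if k ∈ Finset.range (b + 1) then (Real.pi : ℂ) / (k + 1) * (a.choose k) * (b.choose k) *
          (C ^ (a - k) * starRingEnd ℂ C ^ (b - k)) * (R : ℂ) ^ (2 * k) else 0 := by
    intro k
    rw [integral_finsetSum _ fun l _ => hi k l]
    simp only [integral_const_mul, integral_disk_pow_mul_conj_pow, mul_ite, mul_zero]
    rw [Finset.sum_ite_eq]
    split_ifs
    · ring
    · rfl
  simp only [e2]
  rw [← Finset.sum_filter, Finset.mul_sum]
  have hs : (Finset.range (a + 1)).filter (fun k => k ∈ Finset.range (b + 1))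
      = Finset.range (min a b + 1) := by
    ext k; simp only [Finset.mem_filter, Finset.mem_range]; omega
  rw [hs]
  refine Finset.sum_congr rfl fun k _ => ?_
  ring

/-! ### Harmonic potentials of the Fourier data and their pairings. -/

theorem inner_smoothTriple_grad {φ : ℂ → ℂ} {w : TripleSpace} (hw : IsSmoothTriple φ w)
    {ψ : ℂ → ℂ} (hψ : ContDiff ℝ ∞ ψ) :
    inner ℂ w.2.1 (smoothTriple ψ hψ).2.1
      = ∫ z, ∑ j : Fin 2, fderiv ℝ ψ z (coordDir j) *
          starRingEnd ℂ (fderiv ℝ φ z (coordDir j)) ∂diskMeasure := by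
  have hψ' := isSmoothTriple_smoothTriple ψ hψ
  rw [PiLp.inner_apply, integral_finsetSum]
  · refine Finset.sum_congr rfl fun j _ => ?_
    rw [L2.inner_def]
    refine integral_congr_ae ?_
    filter_upwards [hw.2.2.1 j, hψ'.2.2.1 j] with z h1 h2
    rw [h1, h2, RCLike.inner_apply]
  · intro j _
    exact Continuous.integrable_diskMeasure ((continuous_fderiv_apply hψ _).mul
      (Complex.continuous_conj.comp (continuous_fderiv_apply hw.1 _)))

/-- A smooth function that solves the Neumann problem for the Laplacian against smooth test
functions gives the image of the Neumann datum under the adjoint of the trace. -/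
theorem exists_adjoint_gradTrace_eq {ψ : ℂ → ℂ} (hψ : ContDiff ℝ ∞ ψ) (g : L2CircleZero)
    (h : ∀ φ : ℂ → ℂ, ContDiff ℝ ∞ φ →
      ∫ z, ∑ j : Fin 2, fderiv ℝ ψ z (coordDir j) *
          starRingEnd ℂ (fderiv ℝ φ z (coordDir j)) ∂diskMeasure
        = ∫ z, (g : L2Circle) z * starRingEnd ℂ (φ z) ∂circleMeasure) :
    ∃ x : gradients, ContinuousLinearMap.adjoint gradTrace g = x ∧
      ∀ j, (x : GradSpace) j =ᵐ[diskMeasure] fun z => fderiv ℝ ψ z (coordDir j) := by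
  obtain ⟨x, hx, -⟩ := exists_gradients_of_mem_sobolevTriples (smoothTriple_mem ψ hψ)
  refine ⟨x, ext_inner_left ℂ fun y => ?_, fun j => ?_⟩
  · obtain ⟨w, hw, hy1, hy2⟩ := exists_mem_of_gradients y
    rw [inner_adjoint_gradTrace, Submodule.coe_inner, hx, hy1, hy2]
    -- Both sides are continuous in the test triple, so smooth test functions suffice.
    have hcl : IsClosed {w : TripleSpace |
        inner ℂ w.2.2 (g : L2Circle) = inner ℂ w.2.1 (smoothTriple ψ hψ).2.1} := by
      refine isClosed_eq ?_ ?_ <;> fun_prop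
    refine closure_minimal ?_ hcl hw.1
    rintro v ⟨φ, hφ⟩
    change _ = _
    rw [inner_smoothTriple_grad hφ hψ, h φ hφ.1, inner_L2Circle]
    refine integral_congr_ae ?_
    filter_upwards [hφ.2.2.2] with z hz
    rw [hz]
  · rw [hx]
    exact (isSmoothTriple_smoothTriple ψ hψ).2.2.1 j

/-- The gradient of the harmonic function with Neumann datum `f_n`. -/
def trigGrad (n : ℤ) (j : Fin 2) (z : ℂ) : ℂ :=
  if 0 < n then (1 / Real.sqrt (2 * Real.pi) : ℂ) * (z ^ (n.natAbs - 1) * coordDir j)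
  else (1 / Real.sqrt (2 * Real.pi) : ℂ) * starRingEnd ℂ (z ^ (n.natAbs - 1) * coordDir j)

theorem conj_one_div_sqrt_two_pi : starRingEnd ℂ (1 / Real.sqrt (2 * Real.pi) : ℂ)
    = 1 / Real.sqrt (2 * Real.pi) := by
  rw [map_div₀, map_one, Complex.conj_ofReal]

theorem trigGrad_neg {n : ℤ} (hn : n ≠ 0) (j : Fin 2) (z : ℂ) :
    trigGrad (-n) j z = starRingEnd ℂ (trigGrad n j z) := by
  unfold trigGrad
  rcases lt_or_gt_of_ne hn with h | h
  · rw [if_pos (by omega), if_neg (by omega), Int.natAbs_neg, map_mul, Complex.conj_conj,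
      conj_one_div_sqrt_two_pi]
  · rw [if_neg (by omega), if_pos h, Int.natAbs_neg,
      map_mul _ (1 / Real.sqrt (2 * Real.pi) : ℂ), conj_one_div_sqrt_two_pi]

theorem fderiv_const_mul_pow (c : ℂ) (k : ℕ) (z v : ℂ) :
    fderiv ℝ (fun z : ℂ => c / (k + 1) * z ^ (k + 1)) z v = c * (z ^ k * v) := by
  have hk : (k : ℂ) + 1 ≠ 0 := by exact_mod_cast k.succ_ne_zero
  have hpow : ContDiff ℝ ∞ fun z : ℂ => z ^ (k + 1) := contDiff_id.pow _
  rw [fderiv_const_mul (hpow.differentiable (by simp) z), smul_apply, fderiv_pow_complex_apply]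
  simp only [Nat.add_sub_cancel, smul_eq_mul]
  push_cast
  field_simp

/-- The potential is `c z^(k+1) / (k+1)` for `n = k + 1` and its conjugate for `n = -(k + 1)`;
differentiation cancels the denominator. -/
theorem exists_adjoint_gradTrace_trigBasis (n : {n : ℤ // n ≠ 0}) :
    ∃ x : gradients, ContinuousLinearMap.adjoint gradTrace (trigBasis n) = x ∧
      ∀ j, (x : GradSpace) j =ᵐ[diskMeasure] trigGrad n.1 j := by
  obtain ⟨n, hn⟩ := n
  set c : ℂ := (1 / Real.sqrt (2 * Real.pi) : ℂ) with hc
  have hcc : starRingEnd ℂ c = c := conj_one_div_sqrt_two_pi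
  obtain ⟨k, hk⟩ : ∃ k : ℕ, n.natAbs = k + 1 := ⟨n.natAbs - 1, by omega⟩
  have hpow : ContDiff ℝ ∞ fun z : ℂ => c / (k + 1) * z ^ (k + 1) :=
    contDiff_const.mul (contDiff_id.pow _)
  have hf : (trigBasis ⟨n, hn⟩ : L2Circle) =ᵐ[circleMeasure] fun z => c * z ^ n :=
    (memLp_fourier n).coeFn_toLp
  rcases lt_or_gt_of_ne hn with h | h
  · have hder : ∀ z v, fderiv ℝ (fun z => starRingEnd ℂ (c / (k + 1) * z ^ (k + 1))) z v
        = c * starRingEnd ℂ (z ^ k * v) := by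
      intro z v
      rw [fderiv_conj_comp_apply (hpow.differentiable (by simp)), fderiv_const_mul_pow, map_mul,
        hcc]
    obtain ⟨x, hx1, hx2⟩ := exists_adjoint_gradTrace_eq (contDiff_conj.comp hpow)
      (trigBasis ⟨n, hn⟩) (by
        intro φ hφ
        -- For negative `n` the whole Green identity is conjugated; for positive `n` it is applied
        -- to `conj φ` instead.
        have hA := congrArg (starRingEnd ℂ) (integral_pow_mul_dbar k hφ)
        rw [← integral_conj, ← integral_conj] at hA
        have e1 : ∀ z, ∑ j : Fin 2, fderiv ℝ
            ((fun z => starRingEnd ℂ z) ∘ fun z => c / (k + 1) * z ^ (k + 1)) z (coordDir j) *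
            starRingEnd ℂ (fderiv ℝ φ z (coordDir j))
            = c * starRingEnd ℂ (z ^ k *
              (fderiv ℝ φ z 1 + Complex.I * fderiv ℝ φ z Complex.I)) := by
          intro z
          change ∑ j : Fin 2, fderiv ℝ
            (fun z => starRingEnd ℂ (c / (k + 1) * z ^ (k + 1))) z (coordDir j) * _ = _
          rw [Fin.sum_univ_two, hder, hder]
          simp only [coordDir, Matrix.cons_val_zero, Matrix.cons_val_one,
            map_mul, map_add, map_one, Complex.conj_I]
          ring
        simp only [e1]
        rw [integral_const_mul, hA, ← integral_const_mul]
        refine integral_congr_ae ?_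
        filter_upwards [hf, ae_norm_eq_one_circleMeasure] with z hz hz1
        have hinv : starRingEnd ℂ z = z⁻¹ := by
          rw [Complex.inv_def, Complex.normSq_eq_norm_sq, hz1]; simp
        have hnk : n = -((k + 1 : ℕ) : ℤ) := by omega
        rw [hz, map_mul, map_pow, hinv, hnk, zpow_neg, zpow_natCast, inv_pow]
        ring)
    refine ⟨x, hx1, fun j => (hx2 j).trans (Filter.Eventually.of_forall fun z => ?_)⟩
    change fderiv ℝ (fun z => starRingEnd ℂ (c / (k + 1) * z ^ (k + 1))) z (coordDir j)
      = trigGrad n j z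
    rw [hder, trigGrad, if_neg (by omega), hk, Nat.add_sub_cancel]
  · obtain ⟨x, hx1, hx2⟩ := exists_adjoint_gradTrace_eq hpow
      (trigBasis ⟨n, hn⟩) (by
        intro φ hφ
        have hA := integral_pow_mul_dbar k (φ := fun z => starRingEnd ℂ (φ z))
          (contDiff_conj.comp hφ)
        have e1 : ∀ z, ∑ j : Fin 2, fderiv ℝ
            (fun z => c / (k + 1) * z ^ (k + 1)) z (coordDir j) *
            starRingEnd ℂ (fderiv ℝ φ z (coordDir j))
            = c * (z ^ k * (fderiv ℝ (fun z => starRingEnd ℂ (φ z)) z 1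
              + Complex.I * fderiv ℝ (fun z => starRingEnd ℂ (φ z)) z Complex.I)) := by
          intro z
          rw [fderiv_conj_comp_apply (hφ.differentiable (by simp)),
            fderiv_conj_comp_apply (hφ.differentiable (by simp))]
          simp only [fderiv_const_mul_pow, Fin.sum_univ_two, coordDir, Matrix.cons_val_zero,
            Matrix.cons_val_one]
          ring
        simp only [e1]
        rw [integral_const_mul, hA, ← integral_const_mul]
        refine integral_congr_ae ?_
        filter_upwards [hf] with z hz
        have hnk : n = ((k + 1 : ℕ) : ℤ) := by omega
        rw [hz, hnk, zpow_natCast]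
        ring)
    refine ⟨x, hx1, fun j => (hx2 j).trans (Filter.Eventually.of_forall fun z => ?_)⟩
    change fderiv ℝ (fun z => c / (k + 1) * z ^ (k + 1)) z (coordDir j) = trigGrad n j z
    rw [fderiv_const_mul_pow, trigGrad, if_pos h, hk, Nat.add_sub_cancel]

/-- The pairing of the gradients of two harmonic functions with trigonometric Neumann data. -/
def trigPairing (n m : ℤ) (z : ℂ) : ℂ :=
  ∑ j : Fin 2, trigGrad m j z * starRingEnd ℂ (trigGrad n j z)

theorem conj_trigPairing (n m : ℤ) (z : ℂ) :
    starRingEnd ℂ (trigPairing n m z) = trigPairing m n z := by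
  simp only [trigPairing, map_sum, map_mul, Complex.conj_conj, mul_comm]

theorem trigPairing_neg_neg {n m : ℤ} (hn : n ≠ 0) (hm : m ≠ 0) (z : ℂ) :
    trigPairing (-n) (-m) z = starRingEnd ℂ (trigPairing n m z) := by
  simp only [trigPairing, map_sum, map_mul, trigGrad_neg hn, trigGrad_neg hm]

/-- For opposite signs both factors are multiples of the same isotropic vector, `(1, i)` or `(1,
-i)`, and `1 + i² = 0`. The vanishing is pointwise and owes nothing to the shape of the inclusion.
-/
theorem trigPairing_eq_zero {n m : ℤ} (h : (n < 0 ∧ 0 < m) ∨ (0 < n ∧ m < 0)) (z : ℂ) :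
    trigPairing n m z = 0 := by
  simp only [trigPairing, trigGrad, Fin.sum_univ_two, coordDir, Matrix.cons_val_zero,
    Matrix.cons_val_one]
  rcases h with ⟨h1, h2⟩ | ⟨h1, h2⟩
  · rw [if_pos h2, if_neg (by omega), if_pos h2, if_neg (by omega)]
    simp only [map_mul, Complex.conj_conj, map_one]
    ring_nf
    simp
  · rw [if_pos h1, if_neg (by omega), if_pos h1, if_neg (by omega)]
    simp only [map_mul, map_one, Complex.conj_I]
    ring_nf
    simp

/-- Here `(1, i)` meets its conjugate, giving `2`, and `2 / (2π) = 1/π`. -/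
theorem trigPairing_natCast {n m : ℕ} (hn : 0 < n) (hm : 0 < m) (z : ℂ) :
    trigPairing n m z = (1 / Real.pi : ℂ) * (z ^ (m - 1) * starRingEnd ℂ z ^ (n - 1)) := by
  simp only [trigPairing, trigGrad, Fin.sum_univ_two, coordDir, Matrix.cons_val_zero,
    Matrix.cons_val_one, Int.natAbs_natCast]
  rw [if_pos (by omega), if_pos (by omega), if_pos (by omega), if_pos (by omega)]
  simp only [map_mul, map_one, map_pow, Complex.conj_I, conj_one_div_sqrt_two_pi]
  have hs : ((1 / Real.sqrt (2 * Real.pi) : ℂ)) * (1 / Real.sqrt (2 * Real.pi) : ℂ)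
      = 1 / (2 * Real.pi) := by
    rw [div_mul_div_comm, one_mul, ← Complex.ofReal_mul,
      Real.mul_self_sqrt (by positivity)]
    push_cast; rfl
  have hpi : (1 / (2 * Real.pi) : ℂ) * 2 = 1 / Real.pi := by
    have : (Real.pi : ℂ) ≠ 0 := by exact_mod_cast Real.pi_ne_zero
    field_simp
  rw [← hpi, ← hs]
  linear_combination -((1 / Real.sqrt (2 * Real.pi) : ℂ)) * (1 / Real.sqrt (2 * Real.pi) : ℂ) *
    z ^ (m - 1) * starRingEnd ℂ z ^ (n - 1) * Complex.I_sq

/-! ### The matrix of a ball and the main theorem. -/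

theorem ndDerivMatrix_ballIndicator {C : ℂ} {R : ℝ}
    (hCR : Metric.ball C R ⊆ Metric.ball (0 : ℂ) 1) (n m : {n : ℤ // n ≠ 0}) :
    ndDerivMatrix (ballIndicator C R) n m
      = - ∫ z in Metric.ball C R, trigPairing n.1 m.1 z := by
  obtain ⟨x, hx, hx'⟩ := exists_adjoint_gradTrace_trigBasis m
  obtain ⟨y, hy, hy'⟩ := exists_adjoint_gradTrace_trigBasis n
  rw [ndDerivMatrix_apply _ n m x y hx hy]
  congr 1
  have e : ∫ z in Metric.ball C R, trigPairing n.1 m.1 z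
      = ∫ z, (Metric.ball C R).indicator (trigPairing n.1 m.1) z ∂diskMeasure := by
    rw [setIntegral_indicator measurableSet_ball, Set.inter_eq_self_of_subset_right hCR]
  rw [e]
  refine integral_congr_ae ?_
  have hind : ballIndicator C R =ᵐ[diskMeasure] (Metric.ball C R).indicator fun _ => (1 : ℝ) :=
    indicatorConstLp_coeFn
  filter_upwards [hind, hx' 0, hx' 1, hy' 0, hy' 1] with z h0 h1 h2 h3 h4
  rw [h0, Fin.sum_univ_two, h1, h2, h3, h4]
  by_cases hz : z ∈ Metric.ball C R
  · rw [Set.indicator_of_mem hz, Set.indicator_of_mem hz, trigPairing, Fin.sum_univ_two]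
    simp
  · rw [Set.indicator_of_notMem hz, Set.indicator_of_notMem hz]
    simp

theorem pow_mul_conj_pow_polar (c ζ : ℝ) (a b : ℕ) :
    ((c : ℂ) * Complex.exp (Complex.I * ζ)) ^ a *
        starRingEnd ℂ ((c : ℂ) * Complex.exp (Complex.I * ζ)) ^ b
      = Complex.exp (Complex.I * ((a : ℂ) - b) * ζ) * (c : ℂ) ^ (a + b) := by
  rw [map_mul, Complex.conj_ofReal, ← Complex.exp_conj, map_mul, Complex.conj_I,
    Complex.conj_ofReal, mul_pow, mul_pow, ← Complex.exp_nat_mul, ← Complex.exp_nat_mul]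
  have e : Complex.I * ((a : ℂ) - b) * ζ = a * (Complex.I * ζ) + b * (-Complex.I * ζ) := by ring
  rw [e, Complex.exp_add]
  ring

end

theorem mainTheorem2 :
    (∀ γ ∈ LInfPos, ∀ g h : L2CircleZero,
      ndMap γ g = h ↔ ∃ u : H1Disk, IsWeakSolution γ g u h) ∧
    DifferentiableAt ℝ ndMap unitConductivity ∧
    ∀ (c ζ R : ℝ) (C : ℂ), 0 ≤ c → c < 1 → 0 < R → R < 1 - c →
      C = (c : ℂ) * Complex.exp (Complex.I * (ζ : ℂ)) →
      (ndDerivMatrix (ballIndicator C R)).IsHermitian ∧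
      (∀ n m : {n : ℤ // n ≠ 0},
        ndDerivMatrix (ballIndicator C R) n m
          = starRingEnd ℂ (ndDerivMatrix (ballIndicator C R)
              ⟨-n.1, neg_ne_zero.mpr n.2⟩ ⟨-m.1, neg_ne_zero.mpr m.2⟩)) ∧
      (∀ n m : {n : ℤ // n ≠ 0}, (n.1 < 0 ∧ 0 < m.1) ∨ (0 < n.1 ∧ m.1 < 0) →
        ndDerivMatrix (ballIndicator C R) n m = 0) ∧
      (∀ (n m : ℕ) (hn : 0 < n) (hm : 0 < m),
        ndDerivMatrix (ballIndicator C R)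
            ⟨(n : ℤ), by exact_mod_cast hn.ne'⟩ ⟨(m : ℤ), by exact_mod_cast hm.ne'⟩
          = -Complex.exp (Complex.I * ((m : ℂ) - (n : ℂ)) * (ζ : ℂ)) *
              ∑ k ∈ Finset.range (min n m),
                (1 / ((k : ℂ) + 1)) * ((m - 1).choose k : ℂ) * ((n - 1).choose k : ℂ) *
                  (c : ℂ) ^ (m + n - 2 * k - 2) * (R : ℂ) ^ (2 * k + 2)) := by
  refine ⟨fun γ hγ g h => ndMap_eq_iff hγ g h, ?_, ?_⟩
  · obtain ⟨L, hL, -⟩ := hasFDerivAt_ndMap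
    exact hL.differentiableAt
  intro c ζ R C hc _ hR hRc hC
  have hCR : Metric.ball C R ⊆ Metric.ball (0 : ℂ) 1 := by
    refine Metric.ball_subset_ball' ?_
    rw [dist_zero_right, hC, norm_mul, Complex.norm_real, Real.norm_of_nonneg hc,
      Complex.norm_exp_I_mul_ofReal]
    linarith
  have hA := ndDerivMatrix_ballIndicator hCR
  refine ⟨?_, fun n m => ?_, fun n m h => ?_, fun n m hn hm => ?_⟩
  · ext n m
    rw [Matrix.conjTranspose_apply, hA, hA, ← starRingEnd_apply, map_neg, ← integral_conj]
    simp only [conj_trigPairing]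
  · rw [hA, hA, map_neg, ← integral_conj]
    simp only [trigPairing_neg_neg n.2 m.2, Complex.conj_conj]
  · rw [hA]
    simp only [trigPairing_eq_zero h, integral_zero, neg_zero]
  · rw [hA]
    simp only [trigPairing_natCast hn hm]
    rw [integral_const_mul, integral_ball_pow_mul_conj_pow hR, neg_mul, neg_inj, Finset.mul_sum,
      Finset.mul_sum]
    -- The monomials have degrees `m - 1` and `n - 1`, so the moment formula has `min n m` terms.
    have hmin : min (m - 1) (n - 1) + 1 = min n m := by omega
    rw [hmin]
    refine Finset.sum_congr rfl fun k hk => ?_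
    -- The bounds `k < n` and `k < m` make every natural subtraction below exact. At `c = 0` a zero
    -- exponent follows the convention `0 ^ 0 = 1`.
    rw [Finset.mem_range, lt_min_iff] at hk
    rw [hC, pow_mul_conj_pow_polar, Nat.cast_sub (by omega), Nat.cast_sub (by omega),
      Nat.cast_sub (by omega), Nat.cast_sub (by omega),
      (by omega : m - 1 - k + (n - 1 - k) = m + n - 2 * k - 2)]
    have hpi : (Real.pi : ℂ) ≠ 0 := by exact_mod_cast Real.pi_ne_zero
    have hk1 : (k : ℂ) + 1 ≠ 0 := by exact_mod_cast k.succ_ne_zero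
    have e : ((m : ℂ) - (1 : ℕ) - k - (n - (1 : ℕ) - k)) = m - n := by ring
    rw [e]
    field_simp
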